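/- For an integer $b>1$ (the base) let $A_b=\{0,1,\dots,b-1\}$. The value of a word $u=a_0a_1\cdots a_{k-1}$ over $A_b$, written with the least significant digit first, is $\overline{u}=\sum_{i<k}a_ib^i$ (and $0$ for the empty word). A DFA $\mathcal A$ over $A_b$ (deterministic, finite and complete) accepts a set $S\subseteq\mathbb N$ if the words that it accepts are exactly the words $u$ over $A_b$ with $\overline{u}\in S$. It is minimal if no complete DFA accepting the same language has fewer states. A set $S\subseteq\mathbb N$ is ultimately periodic if $S=I\oplus(R+p\mathbb N)$ for some finite $I\subseteq\mathbb N$, some integer $p>0$ and some $R\subseteq\{0,\dots,p-1\}$, where $\oplus$ is symmetric difference. Theorem. There are an algorithm and a constant $C$ such that, for every base $b>1$ and every minimal DFA $\mathcal A$ over $A_b$ with $n$ states, the algorithm, given $b$, $n$ and $\mathcal A$ (its states being numbered $0,\dots,n-1$; the input consists of the initial state, the table of transitions and the table of final states), decides in time at most $C\cdot b\cdot n$ whether $\mathcal A$ accepts an ultimately periodic set. Time is measured on the usual random access machine with words of $O(\log(bn))$ bits, on which each memory access, arithmetic operation ($+,-,\times$, Euclidean division and remainder), comparison and test takes one unit of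 time. -/

import Mathlib

/-! ### Random access machines with bounded words

Programs of a unit-cost word RAM, in structured form.  The machine has natural-number registers
and memory banks, each bank being an array of cells addressed by natural numbers.  The names of
registers and of banks are literals of the program, so that a program mentions only finitely many of
them; the addresses of cells are computed.  Every elementary operation costs one time unit and is
allowed only if its result is a machine word, that is, a number below the word bound `W`. -/

namespace WordRAM

/-- Contents of the registers and of the memory banks (`mem k i` is cell `i` of bank `k`). -/
structure State where
  reg : ℕ → ℕ
  mem : ℕ → ℕ → ℕ

/-- Write the value `v` into register `r`. -/
def State.setReg (σ : State) (r v : ℕ) : State where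
  reg := Function.update σ.reg r v
  mem := σ.mem

/-- Write the value `v` into cell `i` of bank `k`. -/
def State.setMem (σ : State) (k i v : ℕ) : State where
  reg := σ.reg
  mem := Function.update σ.mem k (Function.update (σ.mem k) i v)

/-- The binary operations of the machine. -/
inductive Op where
  | add
  | sub
  | mul
  | div
  | mod
  | lt
  | eq

/-- Subtraction is truncated at `0`, division is Euclidean, comparisons return `1` or `0`. -/
def Op.eval : Op → ℕ → ℕ → ℕ
  | add, x, y => x + y
  | sub, x, y => x - y
  | mul, x, y => x * y
  | div, x, y => x / y
  | mod, x, y => x % y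
  | lt, x, y => if x < y then 1 else 0
  | eq, x, y => if x = y then 1 else 0

/-- Expressions: constants, registers, cells (of a fixed bank, at a computed address), operations. -/
inductive Expr where
  | const (v : ℕ)
  | reg (r : ℕ)
  | load (k : ℕ) (addr : Expr)
  | bin (op : Op) (e₁ e₂ : Expr)

namespace Expr

/-- The value of an expression. -/
def eval (σ : State) : Expr → ℕ
  | const v => v
  | reg r => σ.reg r
  | load k addr => σ.mem k (addr.eval σ)
  | bin op e₁ e₂ => op.eval (e₁.eval σ) (e₂.eval σ)

/-- The values of the expression and of all its subexpressions are below the word bound `W`. -/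
def Fits (W : ℕ) (σ : State) : Expr → Prop
  | const v => v < W
  | reg r => σ.reg r < W
  | load k addr => addr.Fits W σ ∧ σ.mem k (addr.eval σ) < W
  | bin op e₁ e₂ => e₁.Fits W σ ∧ e₂.Fits W σ ∧ op.eval (e₁.eval σ) (e₂.eval σ) < W

/-- The time to evaluate an expression: one unit for each constant, access and operation. -/
def cost : Expr → ℕ
  | const _ => 1
  | reg _ => 1
  | load _ addr => addr.cost + 1
  | bin _ e₁ e₂ => e₁.cost + e₂.cost + 1

end Expr

/-- Programs: assignment to a register, assignment to a cell (bank, address, value), sequencing,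
branching and looping (a condition holds when its value is not `0`). -/
inductive Program where
  | skip
  | assign (r : ℕ) (e : Expr)
  | store (k : ℕ) (addr e : Expr)
  | seq (c d : Program)
  | branch (e : Expr) (c d : Program)
  | loop (e : Expr) (c : Program)

/-- `Exec W c σ t σ'`: started in `σ`, the program `c` halts after `t` time units in the state `σ'`,
and all values and addresses that it has handled were below `W`. -/
inductive Exec (W : ℕ) : Program → State → ℕ → State → Prop
  | skip (σ : State) : Exec W .skip σ 1 σ
  | assign (r : ℕ) (e : Expr) (σ : State) (he : e.Fits W σ) :
      Exec W (.assign r e) σ (e.cost + 1) (σ.setReg r (e.eval σ))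
  | store (k : ℕ) (addr e : Expr) (σ : State) (ha : addr.Fits W σ) (he : e.Fits W σ) :
      Exec W (.store k addr e) σ (addr.cost + e.cost + 1)
        (σ.setMem k (addr.eval σ) (e.eval σ))
  | seq {c d : Program} {σ σ₁ σ₂ : State} {s t : ℕ} (hc : Exec W c σ s σ₁)
      (hd : Exec W d σ₁ t σ₂) : Exec W (.seq c d) σ (s + t) σ₂
  | branch_true {e : Expr} {c d : Program} {σ σ₁ : State} {t : ℕ} (he : e.Fits W σ)
      (h : e.eval σ ≠ 0) (hc : Exec W c σ t σ₁) :
      Exec W (.branch e c d) σ (e.cost + 1 + t) σ₁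
  | branch_false {e : Expr} {c d : Program} {σ σ₁ : State} {t : ℕ} (he : e.Fits W σ)
      (h : e.eval σ = 0) (hd : Exec W d σ t σ₁) :
      Exec W (.branch e c d) σ (e.cost + 1 + t) σ₁
  | loop_true {e : Expr} {c : Program} {σ σ₁ σ₂ : State} {s t : ℕ} (he : e.Fits W σ)
      (h : e.eval σ ≠ 0) (hc : Exec W c σ s σ₁) (hl : Exec W (.loop e c) σ₁ t σ₂) :
      Exec W (.loop e c) σ (e.cost + 1 + s + t) σ₂
  | loop_false {e : Expr} {c : Program} {σ : State} (he : e.Fits W σ) (h : e.eval σ = 0) :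
      Exec W (.loop e c) σ (e.cost + 1) σ

/-- The machine is deterministic: the running time and the final state are functions of the program
and of the initial state. -/
theorem Exec.deterministic {W : ℕ} {c : Program} {σ σ₁ : State} {t₁ : ℕ}
    (h₁ : Exec W c σ t₁ σ₁) : ∀ {t₂ : ℕ} {σ₂ : State}, Exec W c σ t₂ σ₂ → t₁ = t₂ ∧ σ₁ = σ₂ := by
  induction h₁ with
  | skip σ => intro t₂ σ₂ h; cases h; exact ⟨rfl, rfl⟩
  | assign r e σ he => intro t₂ σ₂ h; cases h; exact ⟨rfl, rfl⟩
  | store k addr e σ ha he => intro t₂ σ₂ h; cases h; exact ⟨rfl, rfl⟩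
  | seq hc hd ihc ihd =>
    intro t₂ σ₂ h
    cases h with
    | seq hc' hd' =>
      obtain ⟨rfl, rfl⟩ := ihc hc'
      obtain ⟨rfl, rfl⟩ := ihd hd'
      exact ⟨rfl, rfl⟩
  | branch_true he h hc ih =>
    intro t₂ σ₂ h'
    cases h' with
    | branch_true _ _ hc' => obtain ⟨rfl, rfl⟩ := ih hc'; exact ⟨rfl, rfl⟩
    | branch_false _ h0 _ => exact absurd h0 h
  | branch_false he h hd ih =>
    intro t₂ σ₂ h'
    cases h' with
    | branch_true _ h0 _ => exact absurd h h0
    | branch_false _ _ hd' => obtain ⟨rfl, rfl⟩ := ih hd'; exact ⟨rfl, rfl⟩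
  | loop_true he h hc hl ihc ihl =>
    intro t₂ σ₂ h'
    cases h' with
    | loop_true _ _ hc' hl' =>
      obtain ⟨rfl, rfl⟩ := ihc hc'
      obtain ⟨rfl, rfl⟩ := ihl hl'
      exact ⟨rfl, rfl⟩
    | loop_false _ h0 => exact absurd h0 h
  | loop_false he h =>
    intro t₂ σ₂ h'
    cases h' with
    | loop_true _ h0 _ _ => exact absurd h h0
    | loop_false _ _ => exact ⟨rfl, rfl⟩

open Classical in
/-- The initial state of the machine on the automaton `A` with states `0, …, n - 1` over the digits
`0, …, b - 1`: registers 0, 1, 2 hold `b`, `n` and the initial state, bank 0 holds the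
transition table (the successor of `q` by `a` is in cell `q * b + a`), bank 1 holds the
characteristic function of the set of final states, and everything else is `0`. -/
noncomputable def input {b n : ℕ} (A : DFA (Fin b) (Fin n)) : State where
  reg := fun r => if r = 0 then b else if r = 1 then n else if r = 2 then (A.start : ℕ) else 0
  mem := fun k i =>
    if k = 0 then
      if h : i < b * n then
        (A.step ⟨i / b, Nat.div_lt_of_lt_mul h⟩
          ⟨i % b, Nat.mod_lt i (Nat.pos_of_mul_pos_right (Nat.zero_lt_of_lt h))⟩ : ℕ)
      else 0
    else if k = 1 then
      if h : i < n then (if (⟨i, h⟩ : Fin n) ∈ A.accept then 1 else 0) else 0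
    else 0

end WordRAM

/-! ### Ultimately periodic sets and automata reading numbers -/

/-- `S = R + pℕ` for some positive integer `p` and some `R ⊆ {0, …, p - 1}`. -/
def IsPurelyPeriodic (S : Set ℕ) : Prop :=
  ∃ p : ℕ, 0 < p ∧ ∃ R : Set ℕ, R ⊆ Set.Iio p ∧ S = {m | ∃ r ∈ R, ∃ k : ℕ, m = r + p * k}

/-- `S` is the symmetric difference of a finite set and of a purely periodic set. -/
def IsUltimatelyPeriodic (S : Set ℕ) : Prop :=
  ∃ I S' : Set ℕ, I.Finite ∧ IsPurelyPeriodic S' ∧ S = symmDiff I S'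

namespace DFA

/-- `A` has the least number of states among the (complete) deterministic automata that accept the
same language. -/
def IsMinimal {b n : ℕ} (A : DFA (Fin b) (Fin n)) : Prop :=
  ∀ (m : ℕ) (B : DFA (Fin b) (Fin m)), B.accepts = A.accepts → n ≤ m

/-- `A` accepts the set of numbers `S`: it accepts exactly the words whose value in base `b`, read
with the least significant digit first, is in `S`. -/
def AcceptsSet {b n : ℕ} (A : DFA (Fin b) (Fin n)) (S : Set ℕ) : Prop :=
  ∀ w : List (Fin b), w ∈ A.accepts ↔ Nat.ofDigits b (w.map Fin.val) ∈ S

/-- `A` accepts an ultimately periodic set. -/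
def AcceptsUltimatelyPeriodic {b n : ℕ} (A : DFA (Fin b) (Fin n)) : Prop :=
  ∃ S : Set ℕ, IsUltimatelyPeriodic S ∧ A.AcceptsSet S

end DFA

/-!
Write `z q` for the successor of the state `q` by the digit `0`, and `T q` for the set of numbers
whose words are accepted from `q`, so that `T (q · a) = {m | a + b m ∈ T q}`.

Suppose that the minimal automaton `A` accepts an ultimately periodic set. If a state `s` lies on a
cycle of the transition graph, then `m ∈ T s ↔ v + b ^ k m ∈ T s` for arbitrarily large `k`, and
this removes from the period of `T s` everything that is not coprime to `b`
(`exists_coprime_period`): on the numbers `m ≥ 1`, `T s` has a period `c` with `gcd (b, c) = 1`. The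
same holds for the states reachable from `s`. As `b ^ φ(c) ≡ 1` modulo `c`, the power `φ(c)` of `z`
fixes such states. Hence `z` permutes the *core*, the set of states reachable from a cycle. Going
around the cycle of `z` through `s · 1` shows that the preimage `t s` of `s · 1` under `z` in the
core satisfies `T (t s) = {m | m + 1 ∈ T s}`. Comparing the accepted sets, minimality yields
`s · a = z (t ^ a s)` and `t (z s) = z (t ^ b s)` on the core
(`DFA.IsMinimal.criterion_of_acceptsUltimatelyPeriodic`).

Conversely, these relations give `s · w = z ^ |w| (t ^ v s)` for a word `w` of value `v` and a state
`s` of the core (`DFA.IsTranslation.evalFrom_eq`). If moreover `z` preserves finality, then `T s` is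
the set of the `v` for which `t ^ v s` is final, which is ultimately periodic because the states are
finite in number. All long words lead from the initial state to the core, and so the automaton
accepts an ultimately periodic set (`DFA.IsTranslation.acceptsUltimatelyPeriodic`).

No period has to be found to test these conditions. The core is what remains when states without
predecessors are removed repeatedly, which takes linear time with a table of in-degrees and a queue
(`Peeling`, `peel_runs`). One pass over the core inverts `z`; a last pass checks that the inverse is
correct, that `z` preserves finality, and, running through the iterates `t ^ a s` for `a < b`, that
the relations hold (`checkStates_runs`). Every pass takes `O(b n)` steps, and all numbers that occur
are less than `b n + 10`, which is at most `(b n) ^ 4`.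
-/

/-! ### Ultimately periodic sets -/

/-- Ultimate periodicity in the usual form: membership is invariant under some positive shift from
some point on. -/
theorem isUltimatelyPeriodic_iff {S : Set ℕ} :
    IsUltimatelyPeriodic S ↔ ∃ N p : ℕ, 0 < p ∧ ∀ m, N ≤ m → (m ∈ S ↔ m + p ∈ S) := by
  constructor
  · rintro ⟨I, S', hI, ⟨p, hp, R, hR, rfl⟩, rfl⟩
    obtain ⟨N, hN⟩ := hI.bddAbove
    refine ⟨N + 1, p, hp, fun m hm => ?_⟩
    have h1 : ∀ k, N + 1 ≤ k → k ∉ I := fun k hk h => by have := hN h; omega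
    have h2 : ∀ k, (∃ r ∈ R, ∃ j : ℕ, k = r + p * j) ↔ k % p ∈ R := by
      intro k
      constructor
      · rintro ⟨r, hr, j, rfl⟩
        rwa [Nat.add_mul_mod_self_left, Nat.mod_eq_of_lt (hR hr)]
      · exact fun h => ⟨_, h, k / p, (Nat.mod_add_div k p).symm⟩
    simp only [Set.mem_symmDiff, Set.mem_ofPred_eq, h2, h1 m hm, h1 (m + p) (by omega),
      Nat.add_mod_right]
  · rintro ⟨N, p, hp, h⟩
    have hk : ∀ r k, r + p * N ∈ S ↔ r + p * (N + k) ∈ S := by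
      intro r k
      induction k with
      | zero => rfl
      | succ k ih =>
        rw [ih, h _ (by nlinarith [Nat.zero_le k])]
        ring_nf
    let S' : Set ℕ := {m | ∃ r ∈ {r | r < p ∧ r + p * N ∈ S}, ∃ k : ℕ, m = r + p * k}
    refine ⟨symmDiff S S', S', ?_, ⟨p, hp, _, fun r hr => hr.1, rfl⟩,
      (symmDiff_symmDiff_cancel_right S' S).symm⟩
    refine (Set.finite_Iio (p * N)).subset fun m hm => ?_
    by_contra hmN
    rw [Set.mem_Iio, not_lt] at hmN
    have hdiv : N ≤ m / p := (Nat.le_div_iff_mul_le hp).2 (by rwa [mul_comm])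
    have hS' : m ∈ S' ↔ m ∈ S := by
      have key : m % p + p * N ∈ S ↔ m ∈ S := by
        rw [hk _ (m / p - N), Nat.add_sub_cancel' hdiv, Nat.mod_add_div]
      rw [← key]
      constructor
      · rintro ⟨r, ⟨hr, hrS⟩, k, rfl⟩
        rwa [Nat.add_mul_mod_self_left, Nat.mod_eq_of_lt hr]
      · exact fun hS => ⟨m % p, ⟨Nat.mod_lt _ hp, hS⟩, m / p, (Nat.mod_add_div m p).symm⟩
    rw [Set.mem_symmDiff] at hm
    tauto

/-- If `m ∈ T ↔ v + b ^ k * m ∈ T` for arbitrarily large `k`, then the factor of the period of `T`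
that divides a power of `b` may be dropped: for large `k`, a shift of `m` by the other factor `c`
shifts `v + b ^ k * m` by a multiple of the period. For `m ≥ 1` the number `v + b ^ k * m` is also
beyond any given bound; the number `m = 0` has to be excluded, as `v` may be `0`. -/
theorem exists_coprime_period {b : ℕ} (hb : 1 < b) {T : Set ℕ} {N p : ℕ} (hp : 0 < p)
    (hT : ∀ m, N ≤ m → (m ∈ T ↔ m + p ∈ T))
    (hpow : ∀ j : ℕ, ∃ v k : ℕ, j ≤ k ∧ ∀ m, m ∈ T ↔ v + b ^ k * m ∈ T) :
    ∃ c : ℕ, 0 < c ∧ Nat.Coprime b c ∧ ∀ m, 1 ≤ m → (m ∈ T ↔ m + c ∈ T) := by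
  have hmul : ∀ i m, N ≤ m → (m ∈ T ↔ m + p * i ∈ T) := by
    intro i m hm
    induction i with
    | zero => rfl
    | succ i ih => rw [ih, hT _ (by omega)]; ring_nf
  -- split `p` into a divisor of a power of `b` and a part coprime to `b`
  have hsplit : ∀ p : ℕ, 0 < p → ∃ c j : ℕ, 0 < c ∧ Nat.Coprime b c ∧ p ∣ c * b ^ j := by
    intro p
    induction p using Nat.strong_induction_on with
    | _ p ih =>
      intro hp
      by_cases hg : Nat.gcd b p = 1
      · exact ⟨p, 0, hp, hg, by simp⟩
      · have hgp : 0 < Nat.gcd b p := Nat.gcd_pos_of_pos_right _ hp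
        have h2 : 2 ≤ Nat.gcd b p := by omega
        obtain ⟨c, j, hc, hcop, hdvd⟩ := ih (p / Nat.gcd b p) (Nat.div_lt_self hp h2)
          (Nat.div_pos (Nat.le_of_dvd hp (Nat.gcd_dvd_right b p)) hgp)
        refine ⟨c, j + 1, hc, hcop, ?_⟩
        have := Nat.mul_dvd_mul hdvd (Nat.gcd_dvd_left b p)
        rw [Nat.div_mul_cancel (Nat.gcd_dvd_right b p)] at this
        rwa [pow_succ, ← mul_assoc]
  obtain ⟨c, j, hc, hcop, hdvd⟩ := hsplit p hp
  refine ⟨c, hc, hcop, fun m hm => ?_⟩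
  obtain ⟨v, k, hk, hvk⟩ := hpow (max j N)
  obtain ⟨i, hi⟩ : p ∣ c * b ^ k :=
    hdvd.trans (Nat.mul_dvd_mul_left c (pow_dvd_pow b (le_trans (le_max_left _ _) hk)))
  have hN : N ≤ v + b ^ k * m := by
    have h1 : N ≤ k := le_trans (le_max_right _ _) hk
    have h2 : k < b ^ k := Nat.lt_pow_self hb
    nlinarith
  rw [hvk m, hvk (m + c), hmul i _ hN, ← hi]
  ring_nf

/-- As `b ^ φ(c) ≡ 1` modulo `c`, multiplying `m` by `b ^ φ(c)` changes `v + m` by a multiple of the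
period `c`; for `m = 0` nothing changes, although `T` need not be periodic at `0`. -/
theorem mem_pow_totient_mul_iff {b c : ℕ} {T : Set ℕ} (hb : 0 < b) (hcop : Nat.Coprime b c)
    (hT : ∀ m, 1 ≤ m → (m ∈ T ↔ m + c ∈ T)) (v m : ℕ) :
    v + b ^ c.totient * m ∈ T ↔ v + m ∈ T := by
  rcases Nat.eq_zero_or_pos m with rfl | hm
  · simp
  have hmul : ∀ i, v + m ∈ T ↔ v + m + c * i ∈ T := by
    intro i
    induction i with
    | zero => rfl
    | succ i ih => rw [ih, hT _ (by omega)]; ring_nf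
  have hle : 1 ≤ b ^ c.totient := Nat.one_le_pow _ _ hb
  obtain ⟨i, hi⟩ := (Nat.modEq_iff_dvd' hle).1 (Nat.ModEq.pow_totient hcop).symm
  rw [hmul (i * m), ← mul_assoc, ← hi]
  have : v + m + (b ^ c.totient - 1) * m = v + b ^ c.totient * m := by
    obtain ⟨x, hx⟩ := Nat.exists_eq_add_of_le hle
    rw [hx]; simp; ring
  rw [this]

/-! ### Words and their values -/

namespace DFA

variable {b n : ℕ}

/-- The number written by a word, least significant digit first. -/
def value (w : List (Fin b)) : ℕ := Nat.ofDigits b (w.map Fin.val)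

@[simp] theorem value_nil : value ([] : List (Fin b)) = 0 := by simp [value]

@[simp] theorem value_cons (a : Fin b) (w : List (Fin b)) :
    value (a :: w) = a + b * value w := by
  simp [value, Nat.ofDigits_cons]

theorem value_append (u w : List (Fin b)) : value (u ++ w) = value u + b ^ u.length * value w := by
  simp [value, Nat.ofDigits_append]

theorem exists_word_prefix [NeZero b] (l m : ℕ) :
    ∃ (w : List (Fin b)) (k : ℕ), w.length = l ∧ m = value w + b ^ l * k := by
  induction l generalizing m with
  | zero => exact ⟨[], m, rfl, by simp⟩
  | succ l ih =>
    obtain ⟨w, k, hw, hk⟩ := ih (m / b)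
    refine ⟨⟨m % b, Nat.mod_lt _ (NeZero.pos b)⟩ :: w, k, by simp [hw], ?_⟩
    rw [value_cons, add_assoc, pow_succ']
    calc m = m % b + b * (m / b) := (Nat.mod_add_div m b).symm
      _ = _ := by rw [hk]; ring

theorem exists_value_eq (hb : 1 < b) (m : ℕ) : ∃ w : List (Fin b), value w = m := by
  have : NeZero b := ⟨by omega⟩
  obtain ⟨w, k, hw, hk⟩ := exists_word_prefix (b := b) m m
  have h : m < b ^ m := Nat.lt_pow_self hb
  rcases Nat.eq_zero_or_pos k with rfl | hk0
  · exact ⟨w, by simpa using hk.symm⟩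
  · nlinarith

/-- When the digit `0` preserves finality, acceptance depends only on the value of the word: two
words of the same value differ by trailing zeros. -/
theorem mem_acceptsFrom_iff_of_value_eq [NeZero b] (A : DFA (Fin b) (Fin n))
    (hz : ∀ q, A.step q 0 ∈ A.accept ↔ q ∈ A.accept) (w w' : List (Fin b)) (q : Fin n)
    (h : value w = value w') : w ∈ A.acceptsFrom q ↔ w' ∈ A.acceptsFrom q := by
  have hb := NeZero.pos b
  -- only words of zeros have the value `0`
  have hnil : ∀ (u : List (Fin b)) (q : Fin n), value u = 0 →
      (u ∈ A.acceptsFrom q ↔ q ∈ A.accept) := by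
    intro u
    induction u with
    | nil => intro q _; rfl
    | cons a u ih =>
      intro q hu
      rw [value_cons] at hu
      have ha : a = 0 := Fin.ext (by rw [Fin.val_zero]; omega)
      have hu' : value u = 0 := by
        rcases Nat.eq_zero_or_pos (value u) with h | h
        · exact h
        · have := Nat.mul_pos hb h; omega
      rw [mem_acceptsFrom, evalFrom_cons, ← mem_acceptsFrom, ih _ hu', ha, hz]
  induction w generalizing w' q with
  | nil => rw [hnil [] q rfl, hnil w' q (by simpa using h.symm)]
  | cons a w ih =>
    cases w' with
    | nil => rw [hnil [] q rfl, hnil _ q (by simpa using h)]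
    | cons a' w' =>
      rw [value_cons, value_cons] at h
      have ha : a = a' := by
        have := congrArg (· % b) h
        simp only [Nat.add_mul_mod_self_left, Nat.mod_eq_of_lt a.isLt,
          Nat.mod_eq_of_lt a'.isLt] at this
        exact Fin.ext this
      subst ha
      have hw : value w = value w' := Nat.eq_of_mul_eq_mul_left hb (by omega)
      simp only [mem_acceptsFrom, evalFrom_cons]
      exact ih w' _ hw

/-! ### Minimal automata -/

/-- A minimal automaton has no more states than the automaton of left quotients, so its states are
reachable and pairwise distinguishable. -/
theorem IsMinimal.eval_surjective_and_acceptsFrom_injective {A : DFA (Fin b) (Fin n)}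
    (hA : A.IsMinimal) : Function.Surjective A.eval ∧ Function.Injective A.acceptsFrom := by
  classical
  set L := A.accepts with hL
  have hrange : Set.range L.leftQuotient = A.acceptsFrom '' Set.range A.eval := by
    rw [hL, Language.leftQuotient_accepts, Set.range_comp]
  have hfin : (Set.range L.leftQuotient).Finite := by
    rw [hrange]; exact (Set.toFinite _).image _
  have : Fintype (Set.range L.leftQuotient) := hfin.fintype
  have hn := hA _ (DFA.reindex (Fintype.equivFin _) L.toDFA)
    (by rw [accepts_reindex, Language.accepts_toDFA])
  have hcard : Fintype.card (Set.range L.leftQuotient)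
      = (A.acceptsFrom '' Set.range A.eval).ncard := by
    rw [← hrange, ← Nat.card_coe_set_eq, Nat.card_eq_fintype_card]
  rw [hcard] at hn
  have h1 : (A.acceptsFrom '' Set.range A.eval).ncard ≤ (Set.range A.eval).ncard :=
    Set.ncard_image_le (Set.toFinite _)
  have h2 : (Set.range A.eval).ncard ≤ n := by
    simpa using Set.ncard_le_card (Set.range A.eval)
  have huniv : Set.range A.eval = Set.univ :=
    Set.eq_of_subset_of_ncard_le (Set.subset_univ _)
      (by rw [Set.ncard_univ, Nat.card_fin]; omega) (Set.toFinite _)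
  refine ⟨Set.range_eq_univ.1 huniv, ?_⟩
  have hinj : Set.InjOn A.acceptsFrom (Set.range A.eval) :=
    Set.injOn_of_ncard_image_eq (by omega) (Set.toFinite _)
  rw [huniv] at hinj
  exact Set.injOn_univ.1 hinj

/-! ### The core and the criterion -/

/-- `R` is the core of `A`: what remains when states without predecessors are removed from the
transition graph as long as there are any.  The removal gives a rank that increases along every
transition into a removed state, and every remaining state keeps a predecessor. -/
structure IsCore (A : DFA (Fin b) (Fin n)) (R : Set (Fin n)) : Prop where
  rank : ∃ ρ : Fin n → ℕ, ∀ q a, A.step q a ∉ R → q ∉ R ∧ ρ q < ρ (A.step q a)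
  pred : ∀ r ∈ R, ∃ q ∈ R, ∃ a, A.step q a = r

theorem IsCore.step_mem {A : DFA (Fin b) (Fin n)} {R : Set (Fin n)} (hR : A.IsCore R) {q : Fin n}
    (hq : q ∈ R) (a : Fin b) : A.step q a ∈ R := by
  obtain ⟨ρ, hρ⟩ := hR.rank
  by_contra h
  exact (hρ q a h).1 hq

/-- Ranks increase along a path outside of the core, so that all long words lead to the core. -/
theorem IsCore.exists_forall_length_le {A : DFA (Fin b) (Fin n)} {R : Set (Fin n)}
    (hR : A.IsCore R) : ∃ l, ∀ (w : List (Fin b)) (q : Fin n), l ≤ w.length →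
      A.evalFrom q w ∈ R := by
  obtain ⟨ρ, hρ⟩ := hR.rank
  have key : ∀ (w : List (Fin b)) (q : Fin n), A.evalFrom q w ∉ R →
      w.length ≤ ρ (A.evalFrom q w) := by
    intro w q
    induction w using List.reverseRecOn with
    | nil => simp
    | append_singleton w a ih =>
      intro h
      rw [evalFrom_append_singleton] at h ⊢
      obtain ⟨h1, h2⟩ := hρ _ _ h
      have := ih h1
      simp; omega
  refine ⟨∑ q, ρ q + 1, fun w q hw => ?_⟩
  by_contra h
  have h1 := key w q h
  have h2 : ρ (A.evalFrom q w) ≤ ∑ q, ρ q :=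
    Finset.single_le_sum (fun _ _ => Nat.zero_le _) (Finset.mem_univ _)
  omega

/-- Going back along predecessors in a finite set ends up in a cycle. -/
theorem IsCore.exists_cycle {A : DFA (Fin b) (Fin n)} {R : Set (Fin n)} (hR : A.IsCore R)
    {r : Fin n} (hr : r ∈ R) : ∃ s u v, u ≠ [] ∧ A.evalFrom s u = s ∧ A.evalFrom s v = r := by
  choose! pr hprR a ha using hR.pred
  have hmem : ∀ i, pr^[i] r ∈ R := fun i => by
    induction i with
    | zero => exact hr
    | succ i ih => rw [Function.iterate_succ_apply']; exact hprR _ ih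
  -- from the `k`-th predecessor of a state on the backward path, a word of length `k` leads back
  have hpath : ∀ k i, ∃ w : List (Fin b), w.length = k ∧
      A.evalFrom (pr^[i + k] r) w = pr^[i] r := by
    intro k
    induction k with
    | zero => exact fun i => ⟨[], rfl, rfl⟩
    | succ k ih =>
      intro i
      obtain ⟨w, hw, he⟩ := ih (i + 1)
      refine ⟨w ++ [a _ (hmem i)], by simp [hw], ?_⟩
      rw [evalFrom_append_singleton, show i + (k + 1) = i + 1 + k by omega, he,
        Function.iterate_succ_apply', ha _ (hmem i)]
  obtain ⟨i, j, hij, heq⟩ := Finite.exists_ne_map_eq_of_infinite fun i => pr^[i] r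
  wlog hlt : i < j generalizing i j
  · exact this j i hij.symm heq.symm (by omega)
  obtain ⟨u, hu, hue⟩ := hpath (j - i) i
  obtain ⟨v, -, hve⟩ := hpath i 0
  rw [show i + (j - i) = j by omega] at hue
  refine ⟨pr^[i] r, u, v, ?_, ?_, by simpa using hve⟩
  · rintro rfl; simp at hu; omega
  · rw [← heq] at hue; exact hue

variable [NeZero b]

/-- The translation relations on a set of states `R`: with `z` the action of the digit `0`, reading
the digit `a` is applying `a` times `t` and then `z`, and `t` and `z` commute up to the factor `b`.
In terms of the sets accepted from the states, `t` is the translation `T ↦ {m | m + 1 ∈ T}`. -/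
structure IsTranslation (A : DFA (Fin b) (Fin n)) (R : Set (Fin n)) (t : Fin n → Fin n) :
    Prop where
  mapsTo : ∀ s ∈ R, t s ∈ R
  step_eq : ∀ s ∈ R, ∀ a : Fin b, A.step s a = A.step (t^[a] s) 0
  map_zero : ∀ s ∈ R, t (A.step s 0) = A.step (t^[b] s) 0

/-- The translation relations reduce reading a word to iterating the translation, as many times as
the value of the word. -/
theorem IsTranslation.evalFrom_eq {A : DFA (Fin b) (Fin n)} {R : Set (Fin n)} {t : Fin n → Fin n}
    (ht : A.IsTranslation R t) (hR : ∀ s ∈ R, A.step s 0 ∈ R) (w : List (Fin b)) :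
    ∀ s ∈ R, A.evalFrom s w = (A.step · 0)^[w.length] (t^[value w] s) := by
  have hmem : ∀ v, ∀ s ∈ R, t^[v] s ∈ R := fun v s hs => by
    induction v with
    | zero => exact hs
    | succ v ih => rw [Function.iterate_succ_apply']; exact ht.mapsTo _ ih
  have hcomm : ∀ v, ∀ s ∈ R, t^[v] (A.step s 0) = A.step (t^[b * v] s) 0 := by
    intro v
    induction v with
    | zero => intro s _; rfl
    | succ v ih =>
      intro s hs
      rw [Function.iterate_succ_apply, ht.map_zero s hs, ih _ (hmem b s hs),
        ← Function.iterate_add_apply, mul_add_one]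
  induction w with
  | nil => intro s _; rfl
  | cons a w ih =>
    intro s hs
    rw [evalFrom_cons, ht.step_eq s hs, ih _ (hR _ (hmem _ s hs)), hcomm _ _ (hmem _ s hs),
      ← Function.iterate_add_apply, value_cons, List.length_cons, Function.iterate_succ_apply,
      add_comm (a : ℕ)]

/-- Sufficiency of the criterion: after a long prefix the automaton is in the core, where membership
of `v + b ^ l * k` is finality of the `k`-th iterate of the translation, and the iterates of a self
map of a finite set are ultimately periodic. -/
theorem IsTranslation.acceptsUltimatelyPeriodic (hb : 1 < b) {A : DFA (Fin b) (Fin n)}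
    {R : Set (Fin n)} (hR : A.IsCore R) {t : Fin n → Fin n} (ht : A.IsTranslation R t)
    (hz : ∀ q, A.step q 0 ∈ A.accept ↔ q ∈ A.accept) : A.AcceptsUltimatelyPeriodic := by
  have hacc : ∀ (w w' : List (Fin b)) (q : Fin n), value w = value w' →
      (w ∈ A.acceptsFrom q ↔ w' ∈ A.acceptsFrom q) := mem_acceptsFrom_iff_of_value_eq A hz
  have hfin : ∀ (w : List (Fin b)), ∀ s ∈ R, w ∈ A.acceptsFrom s ↔ t^[value w] s ∈ A.accept := by
    intro w s hs
    rw [mem_acceptsFrom, ht.evalFrom_eq (fun s hs => hR.step_mem hs 0) w s hs]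
    generalize t^[value w] s = x
    induction w.length with
    | zero => rfl
    | succ k ih => rw [Function.iterate_succ_apply', hz, ih]
  refine ⟨{m | ∃ w : List (Fin b), value w = m ∧ w ∈ A.accepts}, ?_, fun w => ?_⟩
  swap
  · constructor
    · exact fun h => ⟨w, rfl, h⟩
    · rintro ⟨w', hw', h⟩
      exact (hacc w' w _ hw').1 h
  obtain ⟨l, hl⟩ := hR.exists_forall_length_le
  obtain ⟨i, j, hij, heq⟩ := Finite.exists_ne_map_eq_of_infinite fun i => t^[i]
  wlog hlt : i < j generalizing i j
  · exact this j i hij.symm heq.symm (by omega)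
  have hper : ∀ k, i ≤ k → t^[k + (j - i)] = t^[k] := by
    intro k hk
    obtain ⟨x, rfl⟩ := Nat.exists_eq_add_of_le hk
    rw [show i + x + (j - i) = x + j by omega, add_comm i x, Function.iterate_add, ← heq,
      ← Function.iterate_add]
  -- numbers with the first `l` digits `u`
  have hmem : ∀ (u : List (Fin b)) (k : ℕ), u.length = l →
      ((∃ w : List (Fin b), value w = value u + b ^ l * k ∧ w ∈ A.accepts) ↔
        t^[k] (A.evalFrom A.start u) ∈ A.accept) := by
    intro u k hu
    obtain ⟨y, rfl⟩ := exists_value_eq hb k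
    have hval : value (u ++ y) = value u + b ^ l * value y := by rw [value_append, hu]
    rw [← hfin y _ (hl u _ hu.ge), mem_acceptsFrom, ← evalFrom_of_append, ← mem_acceptsFrom]
    constructor
    · rintro ⟨w, hw, hwA⟩
      exact (hacc w _ _ (hw.trans hval.symm)).1 hwA
    · exact fun h => ⟨_, hval, h⟩
  refine isUltimatelyPeriodic_iff.2 ⟨b ^ l * (i + 1), b ^ l * (j - i),
    Nat.mul_pos (pow_pos (by omega) l) (by omega), fun m hm => ?_⟩
  obtain ⟨u, k, hu, rfl⟩ := exists_word_prefix (b := b) l m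
  have hval : value u < b ^ l := by
    have := Nat.ofDigits_lt_base_pow_length (b := b) hb (l := u.map Fin.val)
      (by simp only [List.mem_map]; rintro x ⟨a, -, rfl⟩; exact a.isLt)
    simpa [value, hu] using this
  have hk : i ≤ k := by
    by_contra hk
    have h1 : b ^ l * (k + 1) ≤ b ^ l * (i + 1) := Nat.mul_le_mul_left _ (by omega)
    nlinarith
  simp only [Set.mem_ofPred_eq]
  rw [add_assoc, ← mul_add, hmem u k hu, hmem u _ hu, hper k hk]

/-- The sets of numbers accepted from the states of a minimal automaton of an ultimately periodic
set. -/
theorem AcceptsSet.exists_residuals {A : DFA (Fin b) (Fin n)} (hA : A.IsMinimal) {S : Set ℕ}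
    (hS : IsUltimatelyPeriodic S) (h : A.AcceptsSet S) :
    ∃ T : Fin n → Set ℕ, (∀ q w, w ∈ A.acceptsFrom q ↔ value w ∈ T q) ∧
      ∀ q, ∃ N p : ℕ, 0 < p ∧ ∀ m, N ≤ m → (m ∈ T q ↔ m + p ∈ T q) := by
  obtain ⟨hsurj, -⟩ := hA.eval_surjective_and_acceptsFrom_injective
  choose u hu using hsurj
  obtain ⟨N, p, hp, hNp⟩ := isUltimatelyPeriodic_iff.1 hS
  have hmul : ∀ i m, N ≤ m → (m ∈ S ↔ m + p * i ∈ S) := by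
    intro i m hm
    induction i with
    | zero => rfl
    | succ i ih => rw [ih, hNp _ (by omega)]; ring_nf
  refine ⟨fun q => {m | value (u q) + b ^ (u q).length * m ∈ S}, fun q w => ?_, fun q =>
    ⟨N, p, hp, fun m hm => ?_⟩⟩
  · rw [Set.mem_ofPred_eq, ← value_append, mem_acceptsFrom]
    conv_lhs => rw [← hu q, eval, ← evalFrom_of_append]
    exact h (u q ++ w)
  · have h1 : 1 ≤ b ^ (u q).length := Nat.one_le_pow _ _ (NeZero.pos b)
    rw [Set.mem_ofPred_eq, Set.mem_ofPred_eq, hmul (b ^ (u q).length) _ (by nlinarith)]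
    ring_nf

/-- Necessity of the criterion.  All states of the core are reachable from a cycle, so the sets
accepted from them have a period coprime to `b` from `1` on; hence the digit `0` permutes the core,
and `t` is the translation. -/
theorem IsMinimal.criterion_of_acceptsUltimatelyPeriodic (hb : 1 < b) {A : DFA (Fin b) (Fin n)}
    (hA : A.IsMinimal) {R : Set (Fin n)} (hR : A.IsCore R) (h : A.AcceptsUltimatelyPeriodic) :
    (∀ q, A.step q 0 ∈ A.accept ↔ q ∈ A.accept) ∧ Set.InjOn (A.step · 0) R ∧
      ∀ t : Fin n → Fin n, (∀ s ∈ R, t s ∈ R ∧ A.step (t s) 0 = A.step s 1) →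
        A.IsTranslation R t := by
  obtain ⟨S, hS, hAS⟩ := h
  obtain ⟨T, hT, hTup⟩ := hAS.exists_residuals hA hS
  have hmem : ∀ q u m, m ∈ T (A.evalFrom q u) ↔ value u + b ^ u.length * m ∈ T q := by
    intro q u m
    obtain ⟨w, rfl⟩ := exists_value_eq hb m
    rw [← hT, mem_acceptsFrom, ← evalFrom_of_append, ← mem_acceptsFrom, hT, value_append]
  have hstep : ∀ q a m, m ∈ T (A.step q a) ↔ a + b * m ∈ T q := by
    intro q a m
    simpa using hmem q [a] m
  have hzero : ∀ q m, m ∈ T (A.step q 0) ↔ b * m ∈ T q := by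
    intro q m
    simpa using hstep q 0 m
  have hone : ∀ q m, m ∈ T (A.step q 1) ↔ 1 + b * m ∈ T q := by
    intro q m
    have h1 : ((1 : Fin b) : ℕ) = 1 := by rw [Fin.val_one', Nat.mod_eq_of_lt hb]
    have := hstep q 1 m
    rwa [h1] at this
  have hiter : ∀ k q m, m ∈ T ((A.step · 0)^[k] q) ↔ b ^ k * m ∈ T q := by
    intro k q
    induction k with
    | zero => simp
    | succ k ih =>
      intro m
      rw [Function.iterate_succ_apply', hzero, ih, pow_succ, mul_assoc]
  have hinj : ∀ q q', (∀ m, m ∈ T q ↔ m ∈ T q') → q = q' := by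
    intro q q' hqq
    apply hA.eval_surjective_and_acceptsFrom_injective.2
    ext w
    rw [hT, hT, hqq]
  -- the period passes from a state `s` on a cycle to the states reachable from it
  have hper : ∀ r ∈ R, ∃ c : ℕ, 0 < c ∧ Nat.Coprime b c ∧
      ∀ m, 1 ≤ m → (m ∈ T r ↔ m + c ∈ T r) := by
    intro r hr
    obtain ⟨s, u, v, hu, hus, hvr⟩ := hR.exists_cycle hr
    obtain ⟨N, p, hp, hNp⟩ := hTup s
    have hcyc : ∀ j, ∃ w : List (Fin b), j ≤ w.length ∧ A.evalFrom s w = s := by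
      intro j
      induction j with
      | zero => exact ⟨[], le_rfl, rfl⟩
      | succ j ih =>
        obtain ⟨w, hw, hws⟩ := ih
        refine ⟨u ++ w, ?_, by rw [evalFrom_of_append, hus, hws]⟩
        have := List.length_pos_iff.2 hu
        rw [List.length_append]; omega
    obtain ⟨c, hc, hcop, hTc⟩ := exists_coprime_period hb hp hNp fun j => by
      obtain ⟨w, hw, hws⟩ := hcyc j
      refine ⟨value w, w.length, hw, fun m => ?_⟩
      conv_lhs => rw [← hws]
      exact hmem s w m
    refine ⟨c, hc, hcop, fun m hm => ?_⟩
    have hmul : ∀ i x, 1 ≤ x → (x ∈ T s ↔ x + c * i ∈ T s) := by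
      intro i x hx
      induction i with
      | zero => rfl
      | succ i ih => rw [ih, hTc _ (by omega)]; ring_nf
    have h1 : 1 ≤ b ^ v.length := Nat.one_le_pow _ _ (NeZero.pos b)
    rw [← hvr, hmem, hmem, hmul (b ^ v.length) _ (by nlinarith)]
    ring_nf
  have hz : ∀ q, A.step q 0 ∈ A.accept ↔ q ∈ A.accept := by
    intro q
    have h0 : 0 ∈ T (A.step q 0) ↔ 0 ∈ T q := by rw [hzero, mul_zero]
    rw [show (0 : ℕ) = value ([] : List (Fin b)) by simp, ← hT, ← hT] at h0
    exact h0
  -- a common iterate of the action of `0` fixes both states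
  have hzinj : Set.InjOn (A.step · 0) R := by
    intro r hr r' hr' hrr
    simp only at hrr
    obtain ⟨c, hc, hcop, hTc⟩ := hper r hr
    obtain ⟨c', hc', hcop', hTc'⟩ := hper r' hr'
    have hle : 1 ≤ c.totient * c'.totient :=
      Nat.mul_pos (Nat.totient_pos.2 hc) (Nat.totient_pos.2 hc')
    have hback : ∀ r c k, Nat.Coprime b c → (∀ m, 1 ≤ m → (m ∈ T r ↔ m + c ∈ T r)) →
        (A.step · 0)^[c.totient * k] r = r := by
      intro r c k hcop hTc
      rw [Function.iterate_mul]
      refine Function.iterate_fixed (hinj _ _ fun m => ?_) k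
      rw [hiter]
      simpa using mem_pow_totient_mul_iff (by omega) hcop hTc 0 m
    have h1 := hback r c c'.totient hcop hTc
    have h2 := hback r' c' c.totient hcop' hTc'
    rw [mul_comm] at h2
    obtain ⟨k, hk⟩ := Nat.exists_eq_add_of_le' hle
    rw [hk, Function.iterate_succ_apply] at h1 h2
    rw [← h1, ← h2, hrr]
  refine ⟨hz, hzinj, fun t ht => ?_⟩
  -- `t` acts as the translation by `1`
  have htrans : ∀ s ∈ R, ∀ m, m ∈ T (t s) ↔ m + 1 ∈ T s := by
    intro s hs m
    obtain ⟨c, hc, hcop, hTc⟩ := hper s hs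
    obtain ⟨k, hk⟩ := Nat.exists_eq_add_of_le' (Nat.totient_pos.2 hc)
    have hpow : ∀ m, 1 + b ^ (k + 1) * m ∈ T s ↔ 1 + m ∈ T s := fun m => by
      rw [← hk]; exact mem_pow_totient_mul_iff (by omega) hcop hTc 1 m
    -- the preimage of `s · 1` is reached by going around its `0`-cycle
    have hts : t s = (A.step · 0)^[k] (A.step s 1) := by
      have hmemR : ∀ i, ∀ x ∈ R, (A.step · 0)^[i] x ∈ R := fun i x hx => by
        induction i with
        | zero => exact hx
        | succ i ih => rw [Function.iterate_succ_apply']; exact hR.step_mem ih 0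
      refine hzinj (ht s hs).1 (hmemR k _ (hR.step_mem hs 1)) ?_
      simp only
      rw [(ht s hs).2, ← Function.iterate_succ_apply' (A.step · 0) k]
      refine hinj _ _ fun m => ?_
      rw [hiter, hone, hone, ← hpow (b * m), Nat.succ_eq_add_one]
      ring_nf
    rw [hts, hiter, hone, add_comm m 1, ← hpow m, pow_succ']
    ring_nf
  have htR : ∀ v, ∀ s ∈ R, t^[v] s ∈ R := fun v s hs => by
    induction v with
    | zero => exact hs
    | succ v ih => rw [Function.iterate_succ_apply']; exact (ht _ ih).1
  have htiter : ∀ v, ∀ s ∈ R, ∀ m, m ∈ T (t^[v] s) ↔ m + v ∈ T s := by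
    intro v s hs
    induction v with
    | zero => simp
    | succ v ih =>
      intro m
      rw [Function.iterate_succ_apply', htrans _ (htR v s hs), ih]
      ring_nf
  refine ⟨fun s hs => (ht s hs).1, fun s hs a => hinj _ _ fun m => ?_,
    fun s hs => hinj _ _ fun m => ?_⟩
  · rw [hstep, hzero, htiter _ s hs, add_comm]
  · rw [htrans _ (hR.step_mem hs 0), hzero, hzero, htiter _ s hs, mul_add_one]

/-- The conditions that the program tests, for a map `inv` that selects preimages under the digit
`0` in the core. -/
theorem IsMinimal.acceptsUltimatelyPeriodic_iff (hb : 1 < b) {A : DFA (Fin b) (Fin n)}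
    (hA : A.IsMinimal) {R : Set (Fin n)} (hR : A.IsCore R) {inv t : Fin n → Fin n}
    (hinv : ∀ q ∈ R, inv (A.step q 0) ∈ R ∧ A.step (inv (A.step q 0)) 0 = A.step q 0)
    (ht : ∀ q, t q = inv (A.step q 1)) :
    A.AcceptsUltimatelyPeriodic ↔ ∀ q, (A.step q 0 ∈ A.accept ↔ q ∈ A.accept) ∧
      (q ∈ R → inv (A.step q 0) = q ∧ (∀ a : Fin b, A.step q a = A.step (t^[a] q) 0) ∧
        t (A.step q 0) = A.step (t^[b] q) 0) := by
  have htR : Set.InjOn (A.step · 0) R → ∀ s ∈ R, t s ∈ R ∧ A.step (t s) 0 = A.step s 1 := by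
    intro hinj s hs
    have hsurj : Set.SurjOn (A.step · 0) R R :=
      ((Set.toFinite R).injOn_iff_bijOn_of_mapsTo fun s hs => hR.step_mem hs 0).1 hinj |>.surjOn
    obtain ⟨q, hq, hqs⟩ := hsurj (hR.step_mem hs 1)
    simp only at hqs
    rw [ht, ← hqs]
    exact hinv q hq
  constructor
  · intro h q
    obtain ⟨hz, hinj, htr⟩ := hA.criterion_of_acceptsUltimatelyPeriodic hb hR h
    have := htr t (htR hinj)
    exact ⟨hz q, fun hq => ⟨hinj (hinv q hq).1 hq (hinv q hq).2, this.step_eq q hq,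
      this.map_zero q hq⟩⟩
  · intro h
    have hinj : Set.InjOn (A.step · 0) R := by
      intro s hs s' hs' hss
      simp only at hss
      rw [← ((h s).2 hs).1, hss, ((h s').2 hs').1]
    refine IsTranslation.acceptsUltimatelyPeriodic hb hR (t := t)
      ⟨fun s hs => (htR hinj s hs).1, fun s hs => ((h s).2 hs).2.1,
        fun s hs => ((h s).2 hs).2.2⟩ fun q => (h q).1

end DFA

/-! ### Running times of structured programs -/

namespace WordRAM

@[simp] theorem State.setReg_reg (σ : State) (r v s : ℕ) :
    (σ.setReg r v).reg s = if s = r then v else σ.reg s := by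
  simp [State.setReg, Function.update_apply]

@[simp] theorem State.setReg_mem (σ : State) (r v : ℕ) : (σ.setReg r v).mem = σ.mem := rfl

@[simp] theorem State.setMem_reg (σ : State) (k i v : ℕ) : (σ.setMem k i v).reg = σ.reg := rfl

@[simp] theorem State.setMem_mem (σ : State) (k i v j : ℕ) :
    (σ.setMem k i v).mem j = if j = k then Function.update (σ.mem k) i v else σ.mem j := by
  by_cases h : j = k
  · subst h; simp [State.setMem]
  · simp [State.setMem, h]

/-- Started in `σ`, the program halts within `T` time units in a state that satisfies `Q`. -/
def Runs (W : ℕ) (c : Program) (σ : State) (T : ℕ) (Q : State → Prop) : Prop :=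
  ∃ t σ', Exec W c σ t σ' ∧ t ≤ T ∧ Q σ'

namespace Runs

variable {W T T' T₁ T₂ : ℕ} {c d : Program} {σ : State} {Q Q' : State → Prop} {e e₁ e₂ : Expr}

theorem mono (h : Runs W c σ T Q) (hT : T ≤ T') (hQ : ∀ σ', Q σ' → Q' σ') : Runs W c σ T' Q' := by
  obtain ⟨t, σ', h1, h2, h3⟩ := h
  exact ⟨t, σ', h1, h2.trans hT, hQ _ h3⟩

theorem skip (h : Q σ) : Runs W .skip σ 1 Q := ⟨_, _, .skip σ, le_rfl, h⟩

theorem assign {r : ℕ} (he : e.Fits W σ) (h : Q (σ.setReg r (e.eval σ))) :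
    Runs W (.assign r e) σ (e.cost + 1) Q := ⟨_, _, .assign r e σ he, le_rfl, h⟩

theorem store {k : ℕ} (h₁ : e₁.Fits W σ) (h₂ : e₂.Fits W σ)
    (h : Q (σ.setMem k (e₁.eval σ) (e₂.eval σ))) :
    Runs W (.store k e₁ e₂) σ (e₁.cost + e₂.cost + 1) Q :=
  ⟨_, _, .store k e₁ e₂ σ h₁ h₂, le_rfl, h⟩

theorem seq (hc : Runs W c σ T₁ Q') (hd : ∀ σ', Q' σ' → Runs W d σ' T₂ Q) :
    Runs W (.seq c d) σ (T₁ + T₂) Q := by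
  obtain ⟨t, σ', h1, h2, h3⟩ := hc
  obtain ⟨t', σ'', h4, h5, h6⟩ := hd _ h3
  exact ⟨_, _, .seq h1 h4, add_le_add h2 h5, h6⟩

theorem assign_seq {r : ℕ} (he : e.Fits W σ) (hd : Runs W d (σ.setReg r (e.eval σ)) T Q) :
    Runs W (.seq (.assign r e) d) σ (e.cost + 1 + T) Q :=
  seq (Q' := (· = _)) (assign he rfl) fun _ h => h ▸ hd

theorem store_seq {k : ℕ} (h₁ : e₁.Fits W σ) (h₂ : e₂.Fits W σ)
    (hd : Runs W d (σ.setMem k (e₁.eval σ) (e₂.eval σ)) T Q) :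
    Runs W (.seq (.store k e₁ e₂) d) σ (e₁.cost + e₂.cost + 1 + T) Q :=
  seq (Q' := (· = _)) (store h₁ h₂ rfl) fun _ h => h ▸ hd

theorem branch (he : e.Fits W σ) (h₁ : e.eval σ ≠ 0 → Runs W c σ T₁ Q)
    (h₂ : e.eval σ = 0 → Runs W d σ T₂ Q) :
    Runs W (.branch e c d) σ (e.cost + 1 + (T₁ + T₂)) Q := by
  by_cases h : e.eval σ = 0
  · obtain ⟨t, σ', h3, h4, h5⟩ := h₂ h
    exact ⟨_, _, .branch_false he h h3, by omega, h5⟩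
  · obtain ⟨t, σ', h3, h4, h5⟩ := h₁ h
    exact ⟨_, _, .branch_true he h h3, by omega, h5⟩

end Runs

/-- The loop `for i = 0, …, N - 1`, where the names of registers holding the counter and the bound
are given. -/
def forRange (i r : ℕ) (body : Program) : Program :=
  .seq (.assign i (.const 0)) (.loop (.bin .lt (.reg i) (.reg r))
    (.seq body (.assign i (.bin .add (.reg i) (.const 1)))))

theorem Runs.forRange {W i r N T : ℕ} {body : Program} {σ : State} (hir : r ≠ i)
    (I : ℕ → State → Prop) (hr : σ.reg r = N) (hN : N + 1 < W) (h0 : I 0 (σ.setReg i 0))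
    (hbody : ∀ k < N, ∀ τ, I k τ → τ.reg i = k → τ.reg r = N → Runs W body τ T fun τ' =>
      τ'.reg i = k ∧ τ'.reg r = N ∧ I (k + 1) (τ'.setReg i (k + 1))) :
    Runs W (WordRAM.forRange i r body) σ ((T + 8) * N + 6) (I N) := by
  have key : ∀ m k τ, k + m = N → I k τ → τ.reg i = k → τ.reg r = N →
      Runs W (.loop (.bin .lt (.reg i) (.reg r))
        (.seq body (.assign i (.bin .add (.reg i) (.const 1))))) τ ((T + 8) * m + 4) (I N) := by
    intro m
    induction m with
    | zero =>
      intro k τ hk hI hi hrN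
      obtain rfl : k = N := hk
      refine ⟨_, _, .loop_false ?_ ?_, ?_, hI⟩
      · simp [Expr.Fits, Expr.eval, Op.eval, hi, hrN]; omega
      · simp [Expr.eval, Op.eval, hi, hrN]
      · simp [Expr.cost]
    | succ m ih =>
      intro k τ hk hI hi hrN
      obtain ⟨t, τ', h1, h2, h3, h4, h5⟩ := hbody k (by omega) τ hI hi hrN
      have hassign := Exec.assign (W := W) i (.bin .add (.reg i) (.const 1)) τ'
        (by simp [Expr.Fits, Expr.eval, Op.eval, h3]; omega)
      simp only [Expr.eval, Op.eval, h3] at hassign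
      obtain ⟨t', τ'', h6, h7, h8⟩ := ih (k + 1) _ (by omega) h5 (by simp) (by simp [hir, h4])
      refine ⟨_, _, .loop_true ?_ ?_ (.seq h1 hassign) h6, ?_, h8⟩
      · have : k < N := by omega
        simp [Expr.Fits, Expr.eval, Op.eval, hi, hrN, this]; omega
      · have : k < N := by omega
        simp [Expr.eval, Op.eval, hi, hrN, this]
      · simp only [Expr.cost]
        nlinarith
  refine (Runs.assign_seq (T := (T + 8) * N + 4) ?_ ?_).mono ?_ fun _ h => h
  · simp [Expr.Fits]; omega
  · exact key N 0 _ (by omega) h0 (by simp [Expr.eval]) (by simp [hir, hr])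
  · simp [Expr.cost]; omega

end WordRAM

/-! ### Removing the states without predecessors -/

/-- The state of the removal of sources from the graph on `0, …, n - 1` whose edges, numbered by
`i < b * n`, go from `i / b` to `d i`: the edges in `P` have been deleted, `deg` counts the remaining
incoming edges, and `qu 0, …, qu (tail - 1)` are the vertices without remaining incoming edges, in
the order in which they became so. -/
structure Peeling (b n : ℕ) (d : ℕ → ℕ) (P : Finset ℕ) (deg qu : ℕ → ℕ) (tail : ℕ) : Prop where
  deg_eq : ∀ r, deg r = (Finset.filter (d · = r) (Finset.range (b * n) \ P)).card
  qu_lt : ∀ j < tail, qu j < n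
  qu_inj : Set.InjOn qu (Set.Iio tail)
  deg_eq_zero_iff : ∀ r < n, deg r = 0 ↔ ∃ j < tail, qu j = r
  rank : ∀ j < tail, ∀ i < b * n, d i = qu j → ∃ j' < j, qu j' = i / b

namespace Peeling

variable {b n : ℕ} {d : ℕ → ℕ} {P : Finset ℕ} {deg qu : ℕ → ℕ} {tail : ℕ}

theorem tail_le (h : Peeling b n d P deg qu tail) : tail ≤ n := by
  have := Finset.card_le_card_of_injOn (s := Finset.range tail) (t := Finset.range n) qu
    (fun j hj => by simpa using h.qu_lt j (by simpa using hj)) (by simpa using h.qu_inj)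
  simpa using this

theorem deg_le (h : Peeling b n d P deg qu tail) (r : ℕ) : deg r ≤ b * n := by
  rw [h.deg_eq]
  calc _ ≤ (Finset.range (b * n) \ P).card := Finset.card_filter_le _ _
    _ ≤ (Finset.range (b * n)).card := Finset.card_le_card Finset.sdiff_subset
    _ = b * n := Finset.card_range _

theorem deg_ne_zero (h : Peeling b n d P deg qu tail) {i : ℕ} (hi : i < b * n) (hP : i ∉ P) :
    deg (d i) ≠ 0 := by
  rw [h.deg_eq]
  exact Finset.card_ne_zero_of_mem (a := i) (by simp [hi, hP])

theorem deg_erase (h : Peeling b n d P deg qu tail) {i : ℕ} (hi : i < b * n) (hP : i ∉ P) (r : ℕ) :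
    Function.update deg (d i) (deg (d i) - 1) r =
      (Finset.filter (d · = r) (Finset.range (b * n) \ insert i P)).card := by
  have he : Finset.filter (d · = r) (Finset.range (b * n) \ insert i P) =
      (Finset.filter (d · = r) (Finset.range (b * n) \ P)).erase i := by
    ext x
    simp only [Finset.mem_filter, Finset.mem_sdiff, Finset.mem_insert, Finset.mem_erase]
    tauto
  rw [he]
  by_cases hr : r = d i
  · subst hr
    rw [Function.update_self, Finset.card_erase_of_mem (by simp [hi, hP]), h.deg_eq]
  · rw [Function.update_of_ne hr, Finset.erase_eq_of_notMem (by simp [Ne.symm hr]), h.deg_eq]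

/-- Deleting an edge whose target keeps an incoming edge. -/
theorem delete (h : Peeling b n d P deg qu tail) {i : ℕ} (hi : i < b * n) (hP : i ∉ P)
    (hdeg : deg (d i) - 1 ≠ 0) :
    Peeling b n d (insert i P) (Function.update deg (d i) (deg (d i) - 1)) qu tail where
  deg_eq := h.deg_erase hi hP
  qu_lt := h.qu_lt
  qu_inj := h.qu_inj
  deg_eq_zero_iff r hr := by
    rw [← h.deg_eq_zero_iff r hr]
    by_cases hrd : r = d i
    · subst hrd
      rw [Function.update_self]
      omega
    · rw [Function.update_of_ne hrd]
  rank := h.rank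

/-- Deleting the last edge into a vertex, which is appended to the queue.  All its predecessors have
been in the queue before, because edges are deleted only when their source has been. -/
theorem delete_push (h : Peeling b n d P deg qu tail) (hd : ∀ i < b * n, d i < n) {i : ℕ}
    (hi : i < b * n) (hP : i ∉ P) (hdeg : deg (d i) - 1 = 0)
    (hsrc : ∀ x ∈ insert i P, ∃ j < tail, qu j = x / b) :
    Peeling b n d (insert i P) (Function.update deg (d i) (deg (d i) - 1))
      (Function.update qu tail (d i)) (tail + 1) where
  deg_eq := h.deg_erase hi hP
  qu_lt j hj := by
    by_cases hjt : j = tail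
    · subst hjt; simpa using hd i hi
    · rw [Function.update_of_ne hjt]; exact h.qu_lt j (by omega)
  qu_inj := by
    have hnew : ∀ j < tail, qu j ≠ d i := fun j hj hjd =>
      h.deg_ne_zero hi hP ((h.deg_eq_zero_iff _ (hd i hi)).2 ⟨j, hj, hjd⟩)
    intro j hj j' hj' hjj
    simp only [Set.mem_Iio] at hj hj'
    by_cases h1 : j = tail <;> by_cases h2 : j' = tail
    · rw [h1, h2]
    · subst h1
      rw [Function.update_self, Function.update_of_ne h2] at hjj
      exact absurd hjj.symm (hnew j' (by omega))
    · subst h2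
      rw [Function.update_self, Function.update_of_ne h1] at hjj
      exact absurd hjj (hnew j (by omega))
    · rw [Function.update_of_ne h1, Function.update_of_ne h2] at hjj
      exact h.qu_inj (show j < tail by omega) (show j' < tail by omega) hjj
  deg_eq_zero_iff r hr := by
    by_cases hrd : r = d i
    · subst hrd
      rw [Function.update_self]
      exact ⟨fun _ => ⟨tail, by omega, by simp⟩, fun _ => hdeg⟩
    · rw [Function.update_of_ne hrd, h.deg_eq_zero_iff r hr]
      constructor
      · rintro ⟨j, hj, hjr⟩
        exact ⟨j, by omega, by rw [Function.update_of_ne (by omega), hjr]⟩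
      · rintro ⟨j, hj, hjr⟩
        by_cases hjt : j = tail
        · subst hjt; rw [Function.update_self] at hjr; exact absurd hjr.symm hrd
        · exact ⟨j, by omega, by rwa [Function.update_of_ne hjt] at hjr⟩
  rank j hj x hx hxj := by
    have hold : ∀ j₀ ≤ tail, (∃ j' < j₀, qu j' = x / b) →
        ∃ j' < j₀, Function.update qu tail (d i) j' = x / b := by
      rintro j₀ hj₀ ⟨j', hj', he⟩
      exact ⟨j', hj', by rw [Function.update_of_ne (by omega), he]⟩
    by_cases hjt : j = tail
    · subst hjt
      rw [Function.update_self] at hxj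
      refine hold _ le_rfl (hsrc x ?_)
      have hcard := h.deg_erase hi hP (d i)
      rw [Function.update_self, hdeg, eq_comm, Finset.card_eq_zero] at hcard
      by_contra hxP
      have : x ∈ Finset.filter (d · = d i) (Finset.range (b * n) \ insert i P) := by
        simp only [Finset.mem_filter, Finset.mem_sdiff, Finset.mem_range]
        exact ⟨⟨hx, hxP⟩, hxj⟩
      rw [hcard] at this
      simp at this
    · rw [Function.update_of_ne hjt] at hxj
      exact hold _ (by omega) (h.rank j (by omega) x hx hxj)

end Peeling

/-- The outcome of the removal of sources: the vertices with `deg r ≠ 0` are what remains. -/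
structure Peeled (b n : ℕ) (d deg : ℕ → ℕ) : Prop where
  rank : ∃ ρ : ℕ → ℕ, ∀ i < b * n, deg (d i) = 0 → deg (i / b) = 0 ∧ ρ (i / b) < ρ (d i)
  pred : ∀ r < n, deg r ≠ 0 → ∃ i < b * n, d i = r ∧ deg (i / b) ≠ 0

/-- The removal is complete when the deleted edges are the edges with source in the queue. -/
theorem Peeling.peeled {b n : ℕ} {d : ℕ → ℕ} {P : Finset ℕ} {deg qu : ℕ → ℕ} {tail : ℕ}
    (h : Peeling b n d P deg qu tail) (hd : ∀ i < b * n, d i < n)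
    (hP : ∀ i < b * n, i ∈ P ↔ ∃ j < tail, qu j = i / b) : Peeled b n d deg where
  rank := by
    have hdiv : ∀ i < b * n, i / b < n := fun i hi => Nat.div_lt_of_lt_mul hi
    refine ⟨Function.invFunOn qu (Set.Iio tail), fun i hi hdeg => ?_⟩
    obtain ⟨j, hj, hjd⟩ := (h.deg_eq_zero_iff _ (hd i hi)).1 hdeg
    obtain ⟨j', hj', hjd'⟩ := h.rank j hj i hi hjd.symm
    refine ⟨(h.deg_eq_zero_iff _ (hdiv i hi)).2 ⟨j', by omega, hjd'⟩, ?_⟩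
    rw [← hjd, ← hjd', h.qu_inj.leftInvOn_invFunOn (show j < tail from hj),
      h.qu_inj.leftInvOn_invFunOn (show j' < tail by omega)]
    exact hj'
  pred r hr hdeg := by
    rw [h.deg_eq] at hdeg
    obtain ⟨i, hi⟩ := Finset.card_ne_zero.1 hdeg
    simp only [Finset.mem_filter, Finset.mem_sdiff, Finset.mem_range] at hi
    refine ⟨i, hi.1.1, hi.2, fun h0 => hi.1.2 ((hP i hi.1.1).2 ?_)⟩
    exact (h.deg_eq_zero_iff _ (Nat.div_lt_of_lt_mul hi.1.1)).1 h0

/-! ### The program -/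

namespace WordRAM

/-- A word bound `W` that suffices for an automaton with `n` states over `b` digits, whose tables of
transitions and of final states are `d` and `f`. -/
structure Params (W b n : ℕ) (d f : ℕ → ℕ) : Prop where
  one_lt : 1 < b
  pos : 0 < n
  le_bound : b * n + 10 ≤ W
  d_lt : ∀ i < b * n, d i < n
  f_le : ∀ i, f i ≤ 1

/-- The part of the state that no loop of the program changes: registers 0, 1, 3 hold `b`, `n`,
`b * n`, and banks 0 and 1 hold the tables `d` and `f`. -/
structure Frame (b n : ℕ) (d f : ℕ → ℕ) (σ : State) : Prop where
  reg0 : σ.reg 0 = b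
  reg1 : σ.reg 1 = n
  reg3 : σ.reg 3 = b * n
  mem0 : σ.mem 0 = d
  mem1 : σ.mem 1 = f

variable {W b n : ℕ} {d f : ℕ → ℕ}

theorem Params.b_le (h : Params W b n d f) : b ≤ b * n := Nat.le_mul_of_pos_right b h.pos

theorem Params.n_le (h : Params W b n d f) : n ≤ b * n :=
  Nat.le_mul_of_pos_left n (by have := h.one_lt; omega)

theorem edge_lt {q a : ℕ} (hq : q < n) (ha : a < b) : q * b + a < b * n := by
  calc q * b + a < q * b + b := by omega
    _ = b * (q + 1) := by ring
    _ ≤ b * n := Nat.mul_le_mul_left b hq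

theorem edge_div {q a : ℕ} (ha : a < b) : (q * b + a) / b = q := by
  rw [mul_comm, Nat.mul_add_div (by omega), Nat.div_eq_of_lt ha, add_zero]

theorem edge_mod {q a : ℕ} (ha : a < b) : (q * b + a) % b = a := by
  rw [mul_comm, Nat.mul_add_mod, Nat.mod_eq_of_lt ha]

theorem Frame.setReg {σ : State} (h : Frame b n d f σ) {r : ℕ} (v : ℕ) (hr : 4 ≤ r) :
    Frame b n d f (σ.setReg r v) := by
  constructor
  · rw [State.setReg_reg, if_neg (by omega), h.reg0]
  · rw [State.setReg_reg, if_neg (by omega), h.reg1]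
  · rw [State.setReg_reg, if_neg (by omega), h.reg3]
  · exact h.mem0
  · exact h.mem1

theorem Frame.setMem {σ : State} (h : Frame b n d f σ) {k : ℕ} (i v : ℕ) (hk : 2 ≤ k) :
    Frame b n d f (σ.setMem k i v) := by
  constructor
  · exact h.reg0
  · exact h.reg1
  · exact h.reg3
  · rw [State.setMem_mem, if_neg (by omega), h.mem0]
  · rw [State.setMem_mem, if_neg (by omega), h.mem1]

/-- Count in bank 2 the transitions into each state. -/
def countDegrees : Program :=
  forRange 4 3 (.store 2 (.load 0 (.reg 4)) (.bin .add (.load 2 (.load 0 (.reg 4))) (.const 1)))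

theorem countDegrees_runs (hp : Params W b n d f) {σ : State} (hF : Frame b n d f σ)
    (h2 : σ.mem 2 = fun _ => 0) :
    Runs W countDegrees σ (16 * (b * n) + 6) fun τ => Frame b n d f τ ∧
      τ.mem 2 = (fun r => (Finset.filter (d · = r) (Finset.range (b * n))).card) ∧
      τ.mem 4 = σ.mem 4 ∧ τ.reg 6 = σ.reg 6 ∧ τ.reg 7 = σ.reg 7 := by
  have hW := hp.le_bound
  have hn := hp.n_le
  refine (Runs.forRange (N := b * n) (T := 8) (by decide) (fun k τ => Frame b n d f τ ∧
      τ.mem 2 = (fun r => (Finset.filter (d · = r) (Finset.range k)).card) ∧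
      τ.mem 4 = σ.mem 4 ∧ τ.reg 6 = σ.reg 6 ∧ τ.reg 7 = σ.reg 7) hF.reg3 (by omega) ?_ ?_).mono
      (by omega) fun _ h => h
  · exact ⟨hF.setReg _ le_rfl, by simp [h2], by simp, by simp, by simp⟩
  · rintro k hk τ ⟨hτ, hm2, hm4, h6, h7⟩ hi hr
    have hdk := hp.d_lt k hk
    have hcard : (Finset.filter (d · = d k) (Finset.range k)).card ≤ k :=
      (Finset.card_filter_le _ _).trans (Finset.card_range k).le
    refine (Runs.store ?_ ?_ ?_).mono (T := _) (by simp [Expr.cost]) fun _ h => h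
    · simp [Expr.Fits, Expr.eval, hi, hτ.mem0]; omega
    · simp only [Expr.Fits, Expr.eval, Op.eval, hi, hτ.mem0, hm2]
      omega
    · refine ⟨by simp [hi], by simp [hr], (hτ.setMem _ _ le_rfl).setReg _ le_rfl, ?_, by simp [hm4],
        by simp [h6], by simp [h7]⟩
      funext r
      simp only [Expr.eval, Op.eval, hi, hτ.mem0, hm2, State.setReg_mem, State.setMem_mem, if_true,
        Finset.range_add_one, Finset.filter_insert]
      by_cases h : d k = r
      · subst h
        simp
      · rw [Function.update_of_ne (Ne.symm h), if_neg h]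

/-- Put the states without incoming transitions into the queue in bank 3; register 6 holds the
length of the queue. -/
def initQueue : Program :=
  forRange 4 1 (.branch (.bin .eq (.load 2 (.reg 4)) (.const 0))
    (.seq (.store 3 (.reg 6) (.reg 4)) (.assign 6 (.bin .add (.reg 6) (.const 1)))) .skip)

theorem initQueue_runs (hp : Params W b n d f) {σ : State} (hF : Frame b n d f σ)
    (h2 : σ.mem 2 = fun r => (Finset.filter (d · = r) (Finset.range (b * n))).card)
    (h6 : σ.reg 6 = 0) :
    Runs W initQueue σ (30 * (b * n) + 6) fun τ => Frame b n d f τ ∧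
      Peeling b n d ∅ (τ.mem 2) (τ.mem 3) (τ.reg 6) ∧
      τ.mem 4 = σ.mem 4 ∧ τ.reg 7 = σ.reg 7 := by
  have hW := hp.le_bound
  have hn := hp.n_le
  have hdeg : ∀ r, σ.mem 2 r ≤ b * n := fun r => by
    rw [h2]; exact (Finset.card_filter_le _ _).trans (Finset.card_range _).le
  refine (Runs.forRange (N := n) (T := 16) (by decide) (fun k τ => Frame b n d f τ ∧
      τ.mem 2 = σ.mem 2 ∧ τ.mem 4 = σ.mem 4 ∧ τ.reg 7 = σ.reg 7 ∧ τ.reg 6 ≤ k ∧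
      (∀ j < τ.reg 6, τ.mem 3 j < k ∧ σ.mem 2 (τ.mem 3 j) = 0) ∧
      Set.InjOn (τ.mem 3) (Set.Iio (τ.reg 6)) ∧
      ∀ r < k, σ.mem 2 r = 0 → ∃ j < τ.reg 6, τ.mem 3 j = r) hF.reg1 (by omega) ?_ ?_).mono
      (by omega) ?_
  · exact ⟨hF.setReg _ le_rfl, by simp, by simp, by simp, by simp [h6], by simp [h6],
      by simp [h6, Set.InjOn], by simp⟩
  · rintro k hk τ ⟨hτ, hm2, hm4, h7, htail, hlt, hinj, hsurj⟩ hi hr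
    have hdk := hdeg k
    refine (Runs.branch ?_ (fun hc => Runs.store_seq ?_ ?_ (Runs.assign ?_ ?_))
      (fun hc => Runs.skip ?_)).mono (T := _) (by simp [Expr.cost]) fun _ h => h
    · simp only [Expr.Fits, Expr.eval, Op.eval, hi, hm2]
      split <;> omega
    · simp only [Expr.Fits]; omega
    · simp only [Expr.Fits]; omega
    · simp only [Expr.Fits, Expr.eval, Op.eval, State.setMem_reg]; omega
    · have hz : σ.mem 2 k = 0 := by
        by_contra h
        simp [Expr.eval, Op.eval, hi, hm2, h] at hc
      refine ⟨by simp [hi], by simp [hr], ((hτ.setMem _ _ (by decide)).setReg _ (by decide)).setReg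
        _ le_rfl, by simp [hm2], by simp [hm4], by simp [h7],
        by simp [Expr.eval, Op.eval]; omega, ?_, ?_, ?_⟩
      all_goals simp only [Expr.eval, Op.eval, State.setReg_reg, State.setMem_reg, State.setReg_mem,
        State.setMem_mem, hi]
      all_goals simp only [if_true, Nat.reduceEqDiff, if_false]
      · intro j hj
        by_cases hjt : j = τ.reg 6
        · subst hjt; simp [hz]
        · rw [Function.update_of_ne hjt]
          have := hlt j (by omega)
          exact ⟨by omega, this.2⟩
      · intro j hj j' hj' hjj
        simp only [Set.mem_Iio] at hj hj'
        by_cases h1 : j = τ.reg 6 <;> by_cases h2 : j' = τ.reg 6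
        · rw [h1, h2]
        · rw [h1, Function.update_self, Function.update_of_ne h2] at hjj
          have := (hlt j' (by omega)).1; omega
        · rw [h2, Function.update_self, Function.update_of_ne h1] at hjj
          have := (hlt j (by omega)).1; omega
        · rw [Function.update_of_ne h1, Function.update_of_ne h2] at hjj
          exact hinj (show j < τ.reg 6 by omega) (show j' < τ.reg 6 by omega) hjj
      · intro r hrk hr0
        by_cases hrk' : r = k
        · subst hrk'; exact ⟨τ.reg 6, by omega, by simp⟩
        · obtain ⟨j, hj, hjr⟩ := hsurj r (by omega) hr0
          exact ⟨j, by omega, by rw [Function.update_of_ne (by omega), hjr]⟩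
    · have hz : σ.mem 2 k ≠ 0 := by
        intro h
        simp [Expr.eval, Op.eval, hi, hm2, h] at hc
      refine ⟨hi, hr, hτ.setReg _ le_rfl, by simp [hm2], by simp [hm4], by simp [h7],
        by simp; omega, ?_, by simpa using hinj, ?_⟩
      · intro j hj
        have := hlt j (by simpa using hj)
        simp only [State.setReg_mem]
        exact ⟨by omega, this.2⟩
      · intro r hrk hr0
        have hrk' : r ≠ k := fun h => hz (h ▸ hr0)
        simpa using hsurj r (by omega) hr0
  · rintro τ ⟨hτ, hm2, hm4, h7, htail, hlt, hinj, hsurj⟩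
    refine ⟨hτ, ⟨fun r => by rw [hm2, h2, Finset.sdiff_empty], fun j hj => (hlt j hj).1, hinj,
      fun r hr => ?_, fun j hj i hi hij => ?_⟩, hm4, h7⟩
    · rw [hm2]
      refine ⟨hsurj r hr, ?_⟩
      rintro ⟨j, hj, rfl⟩
      exact (hlt j hj).2
    · have := (hlt j hj).2
      rw [h2, Finset.card_eq_zero] at this
      have hmem : i ∈ Finset.filter (d · = τ.mem 3 j) (Finset.range (b * n)) := by simp [hi, hij]
      rw [this] at hmem
      simp at hmem

/-- Delete the transitions from the state in register 8, and append to the queue the states that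
lose their last incoming transition. -/
def deleteEdges : Program :=
  forRange 5 0 (.seq (.assign 9 (.load 0 (.bin .add (.bin .mul (.reg 8) (.reg 0)) (.reg 5))))
    (.seq (.store 2 (.reg 9) (.bin .sub (.load 2 (.reg 9)) (.const 1)))
      (.branch (.bin .eq (.load 2 (.reg 9)) (.const 0))
        (.seq (.store 3 (.reg 6) (.reg 9)) (.assign 6 (.bin .add (.reg 6) (.const 1)))) .skip)))

theorem deleteEdges_runs (hp : Params W b n d f) {σ : State} (hF : Frame b n d f σ) {k : ℕ}
    {P : Finset ℕ} (hPeel : Peeling b n d P (σ.mem 2) (σ.mem 3) (σ.reg 6)) (hk : k < σ.reg 6)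
    (h8 : σ.reg 8 = σ.mem 3 k)
    (hP : ∀ i < b * n, i ∈ P ↔ ∃ j < k, σ.mem 3 j = i / b) (hPlt : ∀ i ∈ P, i < b * n) :
    Runs W deleteEdges σ (60 * b + 6) fun τ => Frame b n d f τ ∧
      (∃ P, Peeling b n d P (τ.mem 2) (τ.mem 3) (τ.reg 6) ∧ (∀ i ∈ P, i < b * n) ∧
        ∀ i < b * n, i ∈ P ↔ ∃ j < k + 1, τ.mem 3 j = i / b) ∧ k < τ.reg 6 ∧
      τ.mem 4 = σ.mem 4 ∧ τ.reg 7 = σ.reg 7 ∧ τ.reg 4 = σ.reg 4 := by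
  have hW := hp.le_bound
  have hn := hp.n_le
  have hb := hp.b_le
  have hq : σ.mem 3 k < n := hPeel.qu_lt k hk
  refine (Runs.forRange (N := b) (T := 40) (by decide) (fun a τ => Frame b n d f τ ∧
      (∃ P, Peeling b n d P (τ.mem 2) (τ.mem 3) (τ.reg 6) ∧ (∀ i ∈ P, i < b * n) ∧
        ∀ i < b * n, i ∈ P ↔ (∃ j < k, τ.mem 3 j = i / b) ∨ (τ.mem 3 k = i / b ∧ i % b < a)) ∧
      k < τ.reg 6 ∧ τ.reg 8 = τ.mem 3 k ∧
      τ.mem 4 = σ.mem 4 ∧ τ.reg 7 = σ.reg 7 ∧ τ.reg 4 = σ.reg 4) hF.reg0 (by omega) ?_ ?_).mono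
      (by omega) ?_
  · exact ⟨hF.setReg _ (by decide), ⟨P, by simpa using hPeel, hPlt, by simpa using hP⟩,
      by simpa using hk, by simpa using h8, by simp, by simp, by simp⟩
  · rintro a ha τ ⟨hτ, ⟨P, hPeel, hPlt, hP⟩, hk, h8, hm4, h7, h4⟩ hi hr
    have hq : τ.mem 3 k < n := hPeel.qu_lt k hk
    have he := edge_lt hq ha
    have htail := hPeel.tail_le
    set e := τ.mem 3 k * b + a with he'
    have hde := hp.d_lt e he
    have hdeg := hPeel.deg_le (d e)
    have hediv : e / b = τ.mem 3 k := edge_div ha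
    have hemod : e % b = a := edge_mod ha
    -- the edge has not been deleted before, as the queue has no repetitions
    have heP : e ∉ P := by
      rw [hP e he, hediv, hemod]
      rintro (⟨j, hj, hjk⟩ | ⟨-, h⟩)
      · have := hPeel.qu_inj (show j < τ.reg 6 by omega) (show k < τ.reg 6 from hk) hjk
        omega
      · omega
    have hstep : ∀ i < b * n, i ∈ insert e P ↔
        (∃ j < k, τ.mem 3 j = i / b) ∨ (τ.mem 3 k = i / b ∧ i % b < a + 1) := by
      intro i hi
      rw [Finset.mem_insert, hP i hi]
      constructor
      · rintro (rfl | h | h)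
        · exact Or.inr ⟨hediv.symm, by omega⟩
        · exact Or.inl h
        · exact Or.inr ⟨h.1, by omega⟩
      · rintro (h | ⟨h, h'⟩)
        · exact Or.inr (Or.inl h)
        · by_cases hia : i % b = a
          · left
            rw [he', h, ← hia, mul_comm, Nat.div_add_mod]
          · exact Or.inr (Or.inr ⟨h, by omega⟩)
    have hsrc : ∀ x ∈ insert e P, ∃ j < τ.reg 6, τ.mem 3 j = x / b := by
      intro x hx
      have hxlt : x < b * n := by
        rcases Finset.mem_insert.1 hx with rfl | h
        · exact he
        · exact hPlt x h
      rcases (hstep x hxlt).1 hx with ⟨j, hj, h⟩ | ⟨h, -⟩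
      · exact ⟨j, by omega, h⟩
      · exact ⟨k, hk, h⟩
    have hPlt' : ∀ i ∈ insert e P, i < b * n := by
      intro x hx
      rcases Finset.mem_insert.1 hx with rfl | h
      · exact he
      · exact hPlt x h
    refine (Runs.assign_seq ?_ (Runs.store_seq ?_ ?_ (Runs.branch ?_
      (fun hc => Runs.store_seq ?_ ?_ (Runs.assign ?_ ?_))
      (fun hc => Runs.skip ?_)))).mono (T := _) (by simp [Expr.cost]) fun _ h => h
    · simp only [Expr.Fits, Expr.eval, Op.eval, hi, hτ.mem0, hτ.reg0, h8, ← he']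
      have : τ.mem 3 k * b ≤ e := by omega
      omega
    all_goals simp only [Expr.Fits, Expr.eval, Op.eval, hi, hτ.mem0, hτ.reg0, h8, State.setReg_reg,
      State.setMem_reg, State.setReg_mem, State.setMem_mem, ← he']
    all_goals simp only [if_true, Nat.reduceEqDiff, if_false, Function.update_self]
    · omega
    · omega
    · split <;> omega
    · omega
    · omega
    · omega
    · have hdeg0 : τ.mem 2 (d e) - 1 = 0 := by
        by_contra h
        simp [Expr.eval, Op.eval, hτ.mem0, hτ.reg0, h8, hi, ← he', h] at hc
      have hnew := hPeel.delete_push hp.d_lt he heP hdeg0 hsrc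
      have hkeep : ∀ j ≤ k, Function.update (τ.mem 3) (τ.reg 6) (d e) j = τ.mem 3 j := fun j hj =>
        Function.update_of_ne (by omega) _ _
      refine ⟨trivial, trivial, ?_, ⟨_, hnew, hPlt', ?_⟩, by omega, ?_, hm4, h7, h4⟩
      · exact ((((hτ.setReg _ (by decide)).setMem _ _ le_rfl).setMem _ _ (by decide)).setReg _
          (by decide)).setReg _ (by decide)
      · intro i hi
        rw [hstep i hi, hkeep k le_rfl]
        refine or_congr ⟨?_, ?_⟩ Iff.rfl
        · rintro ⟨j, hj, h⟩; exact ⟨j, hj, by rw [hkeep j (by omega), h]⟩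
        · rintro ⟨j, hj, h⟩; exact ⟨j, hj, by rw [← hkeep j (by omega), h]⟩
      · rw [hkeep k le_rfl]
    · have hdeg0 : τ.mem 2 (d e) - 1 ≠ 0 := by
        intro h
        simp [Expr.eval, Op.eval, hτ.mem0, hτ.reg0, h8, hi, ← he', h] at hc
      refine ⟨trivial, trivial, ?_, ⟨_, hPeel.delete he heP hdeg0, hPlt', hstep⟩, hk, trivial, hm4,
        h7, h4⟩
      exact ((hτ.setReg _ (by decide)).setMem _ _ le_rfl).setReg _ (by decide)
  · rintro τ ⟨hτ, ⟨P, hPeel, hPlt, hP⟩, hk, h8, hm4, h7, h4⟩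
    refine ⟨hτ, ⟨P, hPeel, hPlt, fun i hi => ?_⟩, hk, hm4, h7, h4⟩
    have hmod : i % b < b := Nat.mod_lt _ (by have := hp.one_lt; omega)
    rw [hP i hi]
    constructor
    · rintro (⟨j, hj, h⟩ | ⟨h, -⟩)
      · exact ⟨j, by omega, h⟩
      · exact ⟨k, by omega, h⟩
    · rintro ⟨j, hj, h⟩
      by_cases hjk : j = k
      · subst hjk; exact Or.inr ⟨h, hmod⟩
      · exact Or.inl ⟨j, by omega, h⟩

/-- Remove the states in the queue one after the other. The queue grows meanwhile, but never beyond
`n`; once the counter has passed its end, the remaining rounds do nothing. -/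
def peel : Program :=
  forRange 4 1 (.branch (.bin .lt (.reg 4) (.reg 6))
    (.seq (.assign 8 (.load 3 (.reg 4))) deleteEdges) .skip)

theorem peel_runs (hp : Params W b n d f) {σ : State} (hF : Frame b n d f σ)
    (hPeel : Peeling b n d ∅ (σ.mem 2) (σ.mem 3) (σ.reg 6)) :
    Runs W peel σ (100 * (b * n) + 6) fun τ => Frame b n d f τ ∧
      Peeled b n d (τ.mem 2) ∧ (∀ r, τ.mem 2 r ≤ b * n) ∧
      τ.mem 4 = σ.mem 4 ∧ τ.reg 7 = σ.reg 7 := by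
  have hW := hp.le_bound
  have hn := hp.n_le
  have hb := hp.one_lt
  refine (Runs.forRange (N := n) (T := 60 * b + 20) (by decide) (fun k τ => Frame b n d f τ ∧
      (∃ P, Peeling b n d P (τ.mem 2) (τ.mem 3) (τ.reg 6) ∧ (∀ i ∈ P, i < b * n) ∧
        ∀ i < b * n, i ∈ P ↔ ∃ j < k, j < τ.reg 6 ∧ τ.mem 3 j = i / b) ∧
      τ.mem 4 = σ.mem 4 ∧ τ.reg 7 = σ.reg 7) hF.reg1 (by omega) ?_ ?_).mono ?_ ?_
  · exact ⟨hF.setReg _ le_rfl, ⟨∅, by simpa using hPeel, by simp, by simp⟩, by simp, by simp⟩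
  · rintro k hk τ ⟨hτ, ⟨P, hPeel, hPlt, hP⟩, hm4, h7⟩ hi hr
    have htail := hPeel.tail_le
    refine (Runs.branch (T₁ := 60 * b + 10) (T₂ := 1) ?_ (fun hc => ?_)
      (fun hc => Runs.skip ?_)).mono (by simp [Expr.cost]; omega) fun _ h => h
    · simp only [Expr.Fits, Expr.eval, Op.eval, hi]
      split <;> omega
    · have hkt : k < τ.reg 6 := by
        by_contra h
        simp [Expr.eval, Op.eval, hi, h] at hc
      have hqk := hPeel.qu_lt k hkt
      refine (Runs.assign_seq ?_ ((deleteEdges_runs hp (hτ.setReg _ (by decide)) (k := k) (P := P)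
        (by simpa using hPeel) (by simpa using hkt) (by simp [Expr.eval, hi]) ?_ hPlt).mono le_rfl
        ?_)).mono (T := _) (by simp [Expr.cost]; omega) fun _ h => h
      · simp only [Expr.Fits, Expr.eval, hi]; omega
      · intro i hi
        rw [hP i hi]
        simp only [State.setReg_mem]
        exact exists_congr fun j => and_congr_right fun hj => and_iff_right (by omega)
      · rintro τ' ⟨hτ', ⟨P', hPeel', hPlt', hP'⟩, hk', hm4', h7', h4'⟩
        refine ⟨by simpa [hi] using h4', hτ'.reg1, hτ'.setReg _ le_rfl,
          ⟨P', by simpa using hPeel', hPlt', fun i hi => ?_⟩, by simp [hm4', hm4],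
          by simp [h7', h7]⟩
        rw [hP' i hi]
        simp only [State.setReg_mem, State.setReg_reg]
        exact exists_congr fun j => and_congr_right fun hj => (and_iff_right (by simp; omega)).symm
    · have hkt : ¬ k < τ.reg 6 := by
        intro h
        simp [Expr.eval, Op.eval, hi, h] at hc
      refine ⟨hi, hr, hτ.setReg _ le_rfl, ⟨P, by simpa using hPeel, hPlt, fun i hi => ?_⟩,
        by simp [hm4], by simp [h7]⟩
      rw [hP i hi]
      simp only [State.setReg_mem, State.setReg_reg, Nat.reduceEqDiff, if_false]
      exact exists_congr fun j => ⟨fun h => ⟨by omega, h.2⟩, fun h => ⟨by omega, h.2⟩⟩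
  · nlinarith [hp.pos]
  · rintro τ ⟨hτ, ⟨P, hPeel, hPlt, hP⟩, hm4, h7⟩
    have htail := hPeel.tail_le
    refine ⟨hτ, hPeel.peeled hp.d_lt fun i hi => ?_, hPeel.deg_le, hm4, h7⟩
    rw [hP i hi]
    exact exists_congr fun j => ⟨fun h => h.2, fun h => ⟨by omega, h⟩⟩

/-- For every remaining state `q`, enter `q` in bank 4 as a preimage of its successor by the
digit `0`. A later preimage overwrites an earlier one, which `checkStates` notices. -/
def fillInverse : Program :=
  forRange 4 1 (.branch (.load 2 (.reg 4))
    (.store 4 (.load 0 (.bin .mul (.reg 4) (.reg 0))) (.reg 4)) .skip)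

/-- `inv` selects preimages under the digit `0` among the states with `deg q ≠ 0`. -/
structure IsInverse (b n : ℕ) (d deg inv : ℕ → ℕ) : Prop where
  lt : ∀ x, inv x < n
  deg_ne_zero : ∀ q < n, deg q ≠ 0 → deg (inv (d (q * b))) ≠ 0
  map_eq : ∀ q < n, deg q ≠ 0 → d (inv (d (q * b)) * b) = d (q * b)

theorem fillInverse_runs (hp : Params W b n d f) {σ : State} (hF : Frame b n d f σ)
    (hdeg : ∀ r, σ.mem 2 r ≤ b * n) (h4 : σ.mem 4 = fun _ => 0) :
    Runs W fillInverse σ (30 * (b * n) + 6) fun τ => Frame b n d f τ ∧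
      τ.mem 2 = σ.mem 2 ∧ IsInverse b n d (σ.mem 2) (τ.mem 4) ∧ τ.reg 7 = σ.reg 7 := by
  have hW := hp.le_bound
  have hn := hp.n_le
  have hn0 := hp.pos
  refine (Runs.forRange (N := n) (T := 16) (by decide) (fun k τ => Frame b n d f τ ∧
      τ.mem 2 = σ.mem 2 ∧ τ.reg 7 = σ.reg 7 ∧ (∀ x, τ.mem 4 x < n) ∧
      ∀ q < k, σ.mem 2 q ≠ 0 → σ.mem 2 (τ.mem 4 (d (q * b))) ≠ 0 ∧
        d (τ.mem 4 (d (q * b)) * b) = d (q * b)) hF.reg1 (by omega) ?_ ?_).mono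
      (by omega) ?_
  · exact ⟨hF.setReg _ le_rfl, by simp, by simp, by simp [h4, hn0], by simp⟩
  · rintro k hk τ ⟨hτ, hm2, h7, hlt, hinv⟩ hi hr
    have he := edge_lt hk (show 0 < b by have := hp.one_lt; omega)
    rw [add_zero] at he
    have hde := hp.d_lt _ he
    have hdk := hdeg k
    have hb := hp.b_le
    refine (Runs.branch ?_ (fun hc => Runs.store ?_ ?_ ?_) (fun hc => Runs.skip ?_)).mono (T := _)
      (by simp [Expr.cost]) fun _ h => h
    · simp only [Expr.Fits, Expr.eval, hi, hm2]; omega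
    · simp only [Expr.Fits, Expr.eval, Op.eval, hi, hτ.mem0, hτ.reg0]; omega
    · simp only [Expr.Fits, hi]; omega
    · have hk0 : σ.mem 2 k ≠ 0 := by simpa [Expr.eval, hi, hm2] using hc
      refine ⟨by simp [hi], by simp [hr], (hτ.setMem _ _ (by decide)).setReg _ le_rfl,
        by simp [hm2], by simp [h7], ?_, ?_⟩
      all_goals simp only [Expr.eval, Op.eval, hi, hτ.mem0, hτ.reg0, State.setReg_mem,
        State.setMem_mem, if_true]
      · intro x
        by_cases hx : x = d (k * b)
        · subst hx; simpa using hk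
        · rw [Function.update_of_ne hx]; exact hlt x
      · intro q hq hq0
        by_cases hx : d (q * b) = d (k * b)
        · rw [hx, Function.update_self]; exact ⟨hk0, rfl⟩
        · rw [Function.update_of_ne hx]
          have hqk : q ≠ k := fun h => hx (h ▸ rfl)
          exact hinv q (by omega) hq0
    · have hk0 : σ.mem 2 k = 0 := by simpa [Expr.eval, hi, hm2] using hc
      refine ⟨hi, hr, hτ.setReg _ le_rfl, by simp [hm2], by simp [h7], by simpa using hlt, ?_⟩
      intro q hq hq0
      have hqk : q ≠ k := fun h => hq0 (h ▸ hk0)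
      simpa using hinv q (by omega) hq0
  · rintro τ ⟨hτ, hm2, h7, hlt, hinv⟩
    exact ⟨hτ, hm2, ⟨hlt, fun q hq h => (hinv q hq h).1, fun q hq h => (hinv q hq h).2⟩, h7⟩

/-- Keep the flag in register 7 if the values of two expressions are equal, and clear it
otherwise. -/
def test (e₁ e₂ : Expr) : Program := .assign 7 (.bin .mul (.reg 7) (.bin .eq e₁ e₂))

theorem Runs.test {σ : State} {e₁ e₂ : Expr} {Q : State → Prop} (hW : 1 < W)
    (h₁ : e₁.Fits W σ) (h₂ : e₂.Fits W σ) (h7 : σ.reg 7 ≤ 1)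
    (hQ : ∀ v, v ≤ 1 → (v = 1 ↔ σ.reg 7 = 1 ∧ e₁.eval σ = e₂.eval σ) → Q (σ.setReg 7 v)) :
    Runs W (test e₁ e₂) σ (e₁.cost + e₂.cost + 4) Q := by
  refine (Runs.assign ?_ (hQ _ ?_ ?_)).mono (by simp only [Expr.cost]; omega) fun _ h => h
  all_goals simp only [Expr.Fits, Expr.eval, Op.eval, h₁, h₂, true_and]
  all_goals by_cases h : e₁.eval σ = e₂.eval σ
  all_goals simp [h]
  all_goals omega

theorem Runs.test_seq {σ : State} {e₁ e₂ : Expr} {c : Program} {T : ℕ} {Q : State → Prop}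
    (hW : 1 < W) (h₁ : e₁.Fits W σ) (h₂ : e₂.Fits W σ) (h7 : σ.reg 7 ≤ 1)
    (hQ : ∀ v, v ≤ 1 → (v = 1 ↔ σ.reg 7 = 1 ∧ e₁.eval σ = e₂.eval σ) →
      Runs W c (σ.setReg 7 v) T Q) :
    Runs W (.seq (WordRAM.test e₁ e₂) c) σ (e₁.cost + e₂.cost + 4 + T) Q :=
  Runs.seq (Q' := fun τ => Runs W c τ T Q) (Runs.test hW h₁ h₂ h7 hQ) fun _ h => h

/-- The translation that the program computes: the selected preimage under the digit `0` of the
successor by the digit `1`. -/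
def shift (b : ℕ) (d inv : ℕ → ℕ) (x : ℕ) : ℕ := inv (d (x * b + 1))

theorem shift_iterate_lt {inv : ℕ → ℕ} (hinv : ∀ x, inv x < n) {q : ℕ} (hq : q < n) (a : ℕ) :
    (shift b d inv)^[a] q < n := by
  induction a with
  | zero => exact hq
  | succ a ih => rw [Function.iterate_succ_apply']; exact hinv _

/-- For the state in registers 4 and 8, compare reading each digit `a` with the `a`-th iterate of
the translation followed by the digit `0`; register 8 runs through the iterates. -/
def checkDigits : Program :=
  forRange 5 0 (.seq (test (.load 0 (.bin .add (.bin .mul (.reg 4) (.reg 0)) (.reg 5)))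
      (.load 0 (.bin .mul (.reg 8) (.reg 0))))
    (.assign 8 (.load 4 (.load 0 (.bin .add (.bin .mul (.reg 8) (.reg 0)) (.const 1))))))

theorem checkDigits_runs (hp : Params W b n d f) {σ : State} (hF : Frame b n d f σ) {q : ℕ}
    (hq : q < n) (hinv : ∀ x, σ.mem 4 x < n) (h4 : σ.reg 4 = q) (h8 : σ.reg 8 = q)
    (h7 : σ.reg 7 ≤ 1) :
    Runs W checkDigits σ (60 * b + 6) fun τ => Frame b n d f τ ∧ τ.mem 2 = σ.mem 2 ∧
      τ.mem 4 = σ.mem 4 ∧ τ.reg 4 = q ∧ τ.reg 8 = (shift b d (σ.mem 4))^[b] q ∧ τ.reg 7 ≤ 1 ∧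
      (τ.reg 7 = 1 ↔ σ.reg 7 = 1 ∧
        ∀ a < b, d (q * b + a) = d ((shift b d (σ.mem 4))^[a] q * b)) := by
  have hW := hp.le_bound
  have hn := hp.n_le
  have hb := hp.b_le
  have hb1 := hp.one_lt
  refine (Runs.forRange (N := b) (T := 40) (by decide) (fun k τ => Frame b n d f τ ∧
      τ.mem 2 = σ.mem 2 ∧ τ.mem 4 = σ.mem 4 ∧ τ.reg 4 = q ∧
      τ.reg 8 = (shift b d (σ.mem 4))^[k] q ∧ τ.reg 7 ≤ 1 ∧
      (τ.reg 7 = 1 ↔ σ.reg 7 = 1 ∧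
        ∀ a < k, d (q * b + a) = d ((shift b d (σ.mem 4))^[a] q * b)))
      hF.reg0 (by omega) ?_ ?_).mono (by omega) fun _ h => h
  · exact ⟨hF.setReg _ (by decide), by simp, by simp, by simp [h4], by simp [h8], by simp [h7],
      by simp⟩
  · rintro k hk τ ⟨hτ, hm2, hm4, h4, h8, h7, hiff⟩ hi hr
    have hx := shift_iterate_lt (b := b) (d := d) hinv hq k
    have he := edge_lt hq hk
    have he0 := edge_lt hx (show 0 < b by omega)
    have he1 := edge_lt hx hb1
    rw [add_zero] at he0
    have hd := hp.d_lt _ he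
    have hd0 := hp.d_lt _ he0
    have hd1 := hp.d_lt _ he1
    have hinvd := hinv (d ((shift b d (σ.mem 4))^[k] q * b + 1))
    have hle : q * b ≤ q * b + k := Nat.le_add_right _ _
    refine (Runs.test_seq (by omega) ?_ ?_ h7 fun v hv hvi => Runs.assign ?_ ?_).mono (T := _)
      (by simp [Expr.cost]) fun _ h => h
    · simp only [Expr.Fits, Expr.eval, Op.eval, hi, hτ.mem0, hτ.reg0, h4]; omega
    · simp only [Expr.Fits, Expr.eval, Op.eval, hτ.mem0, hτ.reg0, h8]; omega
    · simp only [Expr.Fits, Expr.eval, Op.eval, State.setReg_reg, State.setReg_mem,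
        Nat.reduceEqDiff, if_false, reduceCtorEq, hτ.mem0, hτ.reg0, h8, hm4]
      omega
    · refine ⟨by simp [hi], by simp [hr], ((hτ.setReg _ (by decide)).setReg _ (by decide)).setReg _
        (by decide), by simp [hm2], by simp [hm4], by simp [h4], ?_, by simpa using hv, ?_⟩
      · simp only [Expr.eval, Op.eval, State.setReg_reg, State.setReg_mem, Nat.reduceEqDiff,
          if_false, if_true, reduceCtorEq, hτ.mem0, hτ.reg0, h8, hm4,
          Function.iterate_succ_apply']
        rfl
      · simp only [Expr.eval, Op.eval, hi, hτ.mem0, hτ.reg0, h4, h8] at hvi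
        simp only [State.setReg_reg, Nat.reduceEqDiff, if_false, if_true, hvi, hiff,
          and_assoc]
        refine and_congr_right fun _ => ?_
        simp only [Nat.lt_succ_iff_lt_or_eq, or_imp, forall_and, forall_eq]

/-- Run the tests of the criterion on all states. -/
def checkStates : Program :=
  forRange 4 1 (.seq (test (.load 1 (.load 0 (.bin .mul (.reg 4) (.reg 0)))) (.load 1 (.reg 4)))
    (.branch (.load 2 (.reg 4))
      (.seq (test (.load 4 (.load 0 (.bin .mul (.reg 4) (.reg 0)))) (.reg 4))
        (.seq (.assign 8 (.reg 4))
          (.seq checkDigits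
            (test (.load 4 (.load 0 (.bin .add
                (.bin .mul (.load 0 (.bin .mul (.reg 4) (.reg 0))) (.reg 0)) (.const 1))))
              (.load 0 (.bin .mul (.reg 8) (.reg 0)))))))
      .skip))

/-- The tests that the program runs on the state `q`. -/
def Passes (b : ℕ) (d f deg inv : ℕ → ℕ) (q : ℕ) : Prop :=
  f (d (q * b)) = f q ∧ (deg q ≠ 0 → inv (d (q * b)) = q ∧
    (∀ a < b, d (q * b + a) = d ((shift b d inv)^[a] q * b)) ∧
    shift b d inv (d (q * b)) = d ((shift b d inv)^[b] q * b))

theorem checkStates_runs (hp : Params W b n d f) {σ : State} (hF : Frame b n d f σ)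
    (hdeg : ∀ r, σ.mem 2 r ≤ b * n) (hinv : ∀ x, σ.mem 4 x < n) (h7 : σ.reg 7 = 1) :
    Runs W checkStates σ (200 * (b * n) + 6) fun τ => τ.reg 7 ≤ 1 ∧
      (τ.reg 7 = 1 ↔ ∀ q < n, Passes b d f (σ.mem 2) (σ.mem 4) q) := by
  have hW := hp.le_bound
  have hn := hp.n_le
  have hb := hp.b_le
  have hb1 := hp.one_lt
  refine (Runs.forRange (N := n) (T := 60 * b + 70) (by decide) (fun k τ => Frame b n d f τ ∧
      τ.mem 2 = σ.mem 2 ∧ τ.mem 4 = σ.mem 4 ∧ τ.reg 7 ≤ 1 ∧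
      (τ.reg 7 = 1 ↔ ∀ q < k, Passes b d f (σ.mem 2) (σ.mem 4) q)) hF.reg1 (by omega) ?_ ?_).mono
      ?_ fun _ h => h.2.2.2
  · exact ⟨hF.setReg _ le_rfl, by simp, by simp, by simp [h7], by simp [h7]⟩
  · rintro k hk τ ⟨hτ, hm2, hm4, h7, hiff⟩ hi hr
    have he := edge_lt hk (show 0 < b by omega)
    rw [add_zero] at he
    have hde := hp.d_lt _ he
    have he1 := edge_lt hde hb1
    have hde1 := hp.d_lt _ he1
    have hx := shift_iterate_lt (b := b) (d := d) hinv hk b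
    have hex := edge_lt hx (show 0 < b by omega)
    rw [add_zero] at hex
    have hdx := hp.d_lt _ hex
    have hf1 := hp.f_le (d (k * b))
    have hf2 := hp.f_le k
    have hi1 := hinv (d (k * b))
    have hi2 := hinv (d (d (k * b) * b + 1))
    have hdk := hdeg k
    have hsplit : (∀ q < k + 1, Passes b d f (σ.mem 2) (σ.mem 4) q) ↔
        (∀ q < k, Passes b d f (σ.mem 2) (σ.mem 4) q) ∧ Passes b d f (σ.mem 2) (σ.mem 4) k := by
      simp only [Nat.lt_succ_iff_lt_or_eq, or_imp, forall_and, forall_eq]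
    refine (Runs.test_seq (by omega) ?_ ?_ h7 fun v hv hvi => Runs.branch ?_ (fun hc =>
      Runs.test_seq (by omega) ?_ ?_ ?_ fun v' hv' hvi' => Runs.assign_seq ?_
        (Runs.seq (T₂ := 18) (checkDigits_runs hp (q := k) ?_ hk ?_ ?_ ?_ ?_) ?_))
      (fun hc => Runs.skip ?_)).mono (T := _) (T' := 60 * b + 70) ?_ fun _ h => h
    · simp only [Expr.Fits, Expr.eval, Op.eval, hi, hτ.mem0, hτ.mem1, hτ.reg0]; omega
    · simp only [Expr.Fits, Expr.eval, hi, hτ.mem1]; omega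
    · simp only [Expr.Fits, Expr.eval, hi, hm2, State.setReg_reg, State.setReg_mem,
        Nat.reduceEqDiff, if_false]
      omega
    · simp only [Expr.Fits, Expr.eval, Op.eval, hi, hτ.mem0, hτ.reg0, hm4, State.setReg_reg,
        State.setReg_mem, Nat.reduceEqDiff, if_false, OfNat.zero_ne_ofNat]
      omega
    · simp only [Expr.Fits, hi, State.setReg_reg, Nat.reduceEqDiff, if_false]; omega
    · simpa using hv
    · simp only [Expr.Fits, hi, State.setReg_reg, Nat.reduceEqDiff, if_false]; omega
    · exact ((hτ.setReg _ (by decide)).setReg _ (by decide)).setReg _ (by decide)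
    · simpa [hm4] using hinv
    · simp [hi]
    · simp [Expr.eval, hi]
    · simpa using hv'
    · rintro τ' ⟨hτ', hm2', hm4', h4', h8', h7', hiff'⟩
      simp only [State.setReg_mem, hm2, hm4] at hm2' hm4' h8' hiff'
      refine (Runs.test (by omega) ?_ ?_ h7' fun v'' hv'' hvi'' => ?_).mono (T := _)
        (by simp [Expr.cost]) fun _ h => h
      · simp only [Expr.Fits, Expr.eval, Op.eval, h4', hτ'.mem0, hτ'.reg0, hm4']; omega
      · simp only [Expr.Fits, Expr.eval, Op.eval, h8', hτ'.mem0, hτ'.reg0]; omega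
      · refine ⟨by simp [h4'], by simp [hτ'.reg1], (hτ'.setReg _ (by decide)).setReg _ le_rfl,
          by simp [hm2'], by simp [hm4'], by simpa using hv'', ?_⟩
        have hk0 : σ.mem 2 k ≠ 0 := by simpa [Expr.eval, hi, hm2] using hc
        simp only [Expr.eval, Op.eval, h4', h8', hτ'.mem0, hτ'.reg0, hm4', hi, hτ.mem0, hτ.mem1,
          hτ.reg0, hm4, State.setReg_reg, State.setReg_mem, Nat.reduceEqDiff, if_false, if_true,
          OfNat.zero_ne_ofNat] at hvi hvi' hvi'' hiff'
        simp only [State.setReg_reg, Nat.reduceEqDiff, if_false, if_true]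
        rw [hsplit, hvi'', hiff', hvi', hvi, hiff, Passes]
        simp only [shift, and_assoc, ne_eq, hk0, not_false_eq_true, true_imp_iff]
    · have hk0 : σ.mem 2 k = 0 := by simpa [Expr.eval, hi, hm2] using hc
      refine ⟨by simp [hi], by simp [hr], (hτ.setReg _ (by decide)).setReg _ le_rfl,
        by simp [hm2], by simp [hm4], by simpa using hv, ?_⟩
      simp only [Expr.eval, Op.eval, hi, hτ.mem0, hτ.mem1, hτ.reg0] at hvi
      simp only [State.setReg_reg, Nat.reduceEqDiff, if_false, if_true]
      rw [hsplit, hvi, hiff, Passes]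
      simp [hk0]
    · simp [Expr.cost]; omega
  · nlinarith [hp.pos]

/-- The decision procedure; the answer is left in register 0. Register 3 holds `b * n`, registers 4
and 5 are the counters of the loops over states and digits, register 6 is the length of the queue,
register 7 is the flag that the tests clear, and registers 8 and 9 hold states. Banks 2, 3 and 4
hold the in-degrees, the queue and the inverse of the action of the digit `0`. -/
def decidePeriodicity : Program :=
  .seq (.assign 3 (.bin .mul (.reg 0) (.reg 1))) (.seq (.assign 7 (.const 1))
    (.seq countDegrees (.seq initQueue (.seq peel (.seq fillInverse (.seq checkStates
      (.assign 0 (.reg 7))))))))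

theorem decidePeriodicity_runs (hp : Params W b n d f) {σ : State} (h0 : σ.reg 0 = b)
    (h1 : σ.reg 1 = n) (h6 : σ.reg 6 = 0) (hm0 : σ.mem 0 = d) (hm1 : σ.mem 1 = f)
    (hm2 : σ.mem 2 = fun _ => 0) (hm4 : σ.mem 4 = fun _ => 0) :
    Runs W decidePeriodicity σ (500 * (b * n)) fun τ => τ.reg 0 ≤ 1 ∧
      ∃ deg inv, Peeled b n d deg ∧ IsInverse b n d deg inv ∧
        (τ.reg 0 = 1 ↔ ∀ q < n, Passes b d f deg inv q) := by
  have hW := hp.le_bound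
  have hn := hp.n_le
  have hb := hp.b_le
  have hb1 := hp.one_lt
  have hF : Frame b n d f ((σ.setReg 3 (b * n)).setReg 7 1) :=
    ⟨by simp [h0], by simp [h1], by simp, by simp [hm0], by simp [hm1]⟩
  have hcost : 16 * (b * n) + 6 + (30 * (b * n) + 6 + (100 * (b * n) + 6 + (30 * (b * n) + 6 +
      (200 * (b * n) + 6 + 2)))) + 6 ≤ 500 * (b * n) := by omega
  refine (Runs.assign_seq ?_ (Runs.assign_seq ?_ (Runs.seq
    (T₂ := 30 * (b * n) + 6 + (100 * (b * n) + 6 + (30 * (b * n) + 6 + (200 * (b * n) + 6 + 2))))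
    (countDegrees_runs hp
    (by simpa [Expr.eval, Op.eval, h0, h1] using hF) (by simp [hm2])) ?_))).mono (T := _)
    (T' := 500 * (b * n)) (le_trans (by simp only [Expr.cost]; omega) hcost) fun _ h => h
  · simp only [Expr.Fits, Expr.eval, Op.eval, h0, h1]; omega
  · simp only [Expr.Fits]; omega
  · rintro τ₁ ⟨hF₁, hm2₁, hm4₁, h6₁, h7₁⟩
    refine Runs.seq (initQueue_runs hp hF₁ hm2₁ (by simp [h6₁, h6])) ?_
    rintro τ₂ ⟨hF₂, hPeel, hm4₂, h7₂⟩
    refine Runs.seq (peel_runs hp hF₂ hPeel) ?_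
    rintro τ₃ ⟨hF₃, hPeeled, hdeg, hm4₃, h7₃⟩
    refine Runs.seq (fillInverse_runs hp hF₃ hdeg (by simp [hm4₃, hm4₂, hm4₁, hm4])) ?_
    rintro τ₄ ⟨hF₄, hm2₄, hinv, h7₄⟩
    rw [← hm2₄] at hPeeled hinv hdeg
    refine Runs.seq (T₂ := 2) (checkStates_runs hp hF₄ hdeg hinv.lt
      (by simp [h7₄, h7₃, h7₂, h7₁, Expr.eval])) ?_
    rintro τ₅ ⟨hle, hiff⟩
    refine Runs.assign (by simp only [Expr.Fits]; omega) ⟨by simpa [Expr.eval] using hle,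
      _, _, hPeeled, hinv, by simpa [Expr.eval] using hiff⟩

end WordRAM

/-! ### The tables of an automaton -/

namespace WordRAM

variable {b n : ℕ} (A : DFA (Fin b) (Fin n))

theorem input_mem_zero {q : Fin n} {a : Fin b} :
    (input A).mem 0 (q * b + a) = A.step q a := by
  have h : (q : ℕ) * b + a < b * n := edge_lt q.isLt a.isLt
  simp only [input, if_true, dif_pos h]
  congr 2
  · exact Fin.ext (edge_div a.isLt)
  · exact Fin.ext (edge_mod a.isLt)

theorem input_mem_one_eq_iff (q q' : Fin n) :
    (input A).mem 1 q = (input A).mem 1 q' ↔ (q ∈ A.accept ↔ q' ∈ A.accept) := by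
  simp only [input, one_ne_zero, if_false, if_true, dif_pos q.isLt, dif_pos q'.isLt, Fin.eta]
  by_cases h : q ∈ A.accept <;> by_cases h' : q' ∈ A.accept <;> simp [h, h']

theorem params_input (hb : 1 < b) (hn : 0 < n) :
    Params ((b * n) ^ 4) b n ((input A).mem 0) ((input A).mem 1) where
  one_lt := hb
  pos := hn
  le_bound := by
    have h2 : 2 ≤ b * n := le_trans hb (Nat.le_mul_of_pos_right b hn)
    have h8 : 2 ^ 3 ≤ (b * n) ^ 3 := Nat.pow_le_pow_left h2 3
    rw [pow_succ]
    nlinarith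
  d_lt i hi := by
    simp only [input, if_true, dif_pos hi]
    exact Fin.isLt _
  f_le i := by
    simp only [input, one_ne_zero, if_false, if_true]
    split_ifs <;> simp

variable {A}

theorem _root_.Peeled.isCore {deg : ℕ → ℕ} (h : Peeled b n ((input A).mem 0) deg) :
    A.IsCore {q | deg q ≠ 0} where
  rank := by
    obtain ⟨ρ, hρ⟩ := h.rank
    refine ⟨fun q => ρ q, fun q a hqa => ?_⟩
    have := hρ (q * b + a) (edge_lt q.isLt a.isLt)
    rw [input_mem_zero, edge_div a.isLt] at this
    have h' := this (by simpa using hqa)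
    exact ⟨by simpa using h'.1, h'.2⟩
  pred r hr := by
    obtain ⟨i, hi, hir, hdeg⟩ := h.pred r r.isLt hr
    have hb : 0 < b := Nat.pos_of_ne_zero (by rintro rfl; simp at hi)
    refine ⟨⟨i / b, Nat.div_lt_of_lt_mul hi⟩, hdeg, ⟨i % b, Nat.mod_lt _ hb⟩, Fin.ext ?_⟩
    rw [← hir, ← input_mem_zero]
    simp only
    rw [mul_comm, Nat.div_add_mod]

/-- The tests of the program express the criterion. -/
theorem forall_passes_iff (hb : 1 < b) (hA : A.IsMinimal) {deg inv : ℕ → ℕ}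
    (hdeg : Peeled b n ((input A).mem 0) deg) (hinv : IsInverse b n ((input A).mem 0) deg inv) :
    (∀ q < n, Passes b ((input A).mem 0) ((input A).mem 1) deg inv q) ↔
      A.AcceptsUltimatelyPeriodic := by
  have : NeZero b := ⟨by omega⟩
  have hone : ((1 : Fin b) : ℕ) = 1 := by rw [Fin.val_one', Nat.mod_eq_of_lt hb]
  have hstep0 : ∀ q : Fin n, (input A).mem 0 (q * b) = A.step q 0 := fun q => by
    rw [← input_mem_zero, Fin.val_zero, add_zero]
  have hstep1 : ∀ q : Fin n, (input A).mem 0 (q * b + 1) = A.step q 1 := fun q => by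
    rw [← input_mem_zero, hone]
  let inv' : Fin n → Fin n := fun q => ⟨inv q, hinv.lt q⟩
  let t : Fin n → Fin n := fun q => inv' (A.step q 1)
  have hshift : ∀ q : Fin n, shift b ((input A).mem 0) inv q = t q := fun q => by
    rw [shift, hstep1]
  have hiter : ∀ (a : ℕ) (q : Fin n), (shift b ((input A).mem 0) inv)^[a] q =
      (t^[a] q : Fin n) := by
    intro a q
    induction a with
    | zero => rfl
    | succ a ih => rw [Function.iterate_succ_apply', Function.iterate_succ_apply', ih, hshift]
  rw [hA.acceptsUltimatelyPeriodic_iff hb hdeg.isCore (inv := inv') (t := t) ?_ fun _ => rfl]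
  · rw [← Fin.forall_iff (p := fun q => Passes b ((input A).mem 0) ((input A).mem 1) deg inv q)]
    refine forall_congr' fun q => and_congr ?_ (imp_congr Iff.rfl (and_congr ?_ (and_congr ?_ ?_)))
    · rw [hstep0, input_mem_one_eq_iff]
    · rw [hstep0, Fin.ext_iff]
    · rw [Fin.forall_iff]
      refine forall_congr' fun a => forall_congr' fun ha => ?_
      rw [hiter, hstep0, Fin.ext_iff, ← input_mem_zero A (a := ⟨a, ha⟩)]
    · rw [hiter, hstep0, hstep0, hshift, Fin.ext_iff]
  · intro q hq
    have h1 := hinv.deg_ne_zero q q.isLt hq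
    have h2 := hinv.map_eq q q.isLt hq
    rw [hstep0] at h1 h2
    refine ⟨h1, Fin.ext ?_⟩
    rw [← h2, ← hstep0]

end WordRAM

/-- One program of the word RAM, with words of `O(log (b n))` bits, decides in time `O(b n)` whether
a minimal automaton with `n` states over the digits of base `b`, read with the least significant
digit first, accepts an ultimately periodic set; the answer `1` or `0` is left in register `0`. The
program and the constants do not depend on `b`. -/
theorem mainTheorem1 :
    ∃ (P : WordRAM.Program) (C w : ℕ), ∀ (b n : ℕ) (A : DFA (Fin b) (Fin n)),
      1 < b → A.IsMinimal →
        ∃ (t : ℕ) (σ : WordRAM.State),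
          WordRAM.Exec ((b * n) ^ w) P (WordRAM.input A) t σ ∧
          t ≤ C * (b * n) ∧
          (A.AcceptsUltimatelyPeriodic → σ.reg 0 = 1) ∧
          (¬ A.AcceptsUltimatelyPeriodic → σ.reg 0 = 0) := by
  refine ⟨WordRAM.decidePeriodicity, 500, 4, fun b n A hb hA => ?_⟩
  obtain ⟨t, σ, hexec, ht, hle, deg, inv, hdeg, hinv, hiff⟩ :=
    WordRAM.decidePeriodicity_runs (σ := WordRAM.input A)
      (WordRAM.params_input A hb A.start.pos) rfl rfl rfl rfl rfl rfl rfl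
  rw [WordRAM.forall_passes_iff hb hA hdeg hinv] at hiff
  refine ⟨t, σ, hexec, ht, hiff.2, fun h => ?_⟩
  have : σ.reg 0 ≠ 1 := fun h1 => h (hiff.1 h1)
  omega
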